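/- Let $(M,g)$ be a smooth Riemannian manifold, $\mathring\nabla$ its Levi-Civita connection and $H$ a closed 3-form on $M$. The $H$-twisted standard Courant algebroid is $TM\oplus T^*M$ with pairing $\langle v\oplus\eta,w\oplus\zeta\rangle=\eta(w)+\zeta(v)$ and bracket $[v\oplus\eta,w\oplus\zeta]=[v,w]\oplus\big(\mathcal L_v\zeta-\mathcal L_w\eta-\tfrac12 d(\zeta(v)-\eta(w))+H(v,w,\cdot)\big)$. A Dirac structure is a smooth subbundle of rank $\dim M$ that is isotropic and closed under this bracket. Write $v^*=g(v,\cdot)$ and $\eta^*=g^{-1}(\eta,\cdot)$. For a smooth field $\mathcal O$ of $g$-orthogonal operators on $TM$ put $u_{\mathcal O}(\mathfrak a)=(\mathrm{id}-\mathcal O)\mathfrak a\oplus((\mathrm{id}+\mathcal O)\mathfrak a)^*$; a subbundle is parametrized by $\mathcal O$ if it equals $\{u_{\mathcal O}(\mathfrak a):\mathfrak a\in TM\}$. Let $D$ be a Dirac structure and let $\rho:D\to TM$, $\theta:D\to T^*M$ be smooth bundle maps such that the image $\widetilde D$ of $D$ under $\rho\oplus\theta$ is again a Dirac structure. Then: (1)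 The bundle maps $\theta^*\pm\rho:D\to TM$ (where $\theta^*(e)=\theta(e)^*$) are invertible, with smooth inverses. (2) Let $\nabla^D$ be any connection on $D$ (for instance the Levi-Civita connection of $TM$ carried to $D$ by an isomorphism $TM\cong D$), with coefficients $\Gamma^a_{bi}$, $\nabla^D e_b=\Gamma^a_{bi}\,dx^i\otimes e_a$, in a local frame $(e_a)$ of $D$. Let $\mathring\nabla_i\rho$ and $\mathring\nabla_i(\theta^*+\rho)$ be formed with $\mathring\nabla$ on $TM$ and $\nabla^D$ on $D$, and put $$T^a_{bi}=[(\theta^*+\rho)^{-1}]^a_k\Big(\mathring\nabla_i(\theta^*+\rho)^k_b-\tfrac12\rho^l_bH^k{}_{li}\Big),\quad \phi^a_{bi}=[(\theta^*-\rho)^{-1}]^a_k\Big(\mathring\nabla_i\rho^k_b-\rho^k_cT^c_{bi}\Big),\quad \omega^a_{bi}=\Gamma^a_{bi}-\phi^a_{bi}+T^a_{bi}.$$ Then $T$ and $\phi$ are smooth sections of $T^*M\otimes\mathrm{End}(D)$, $\nabla^\omega e_b=\omega^a_{bi}dx^i\otimes e_a$ defines a connection on $D$, and, with $\rho_a=\rho(e_a)$,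 $\theta_a=\theta(e_a)$, $\alpha\vee\beta=\alpha\otimes\beta+\beta\otimes\alpha$, $\alpha\wedge\beta=\alpha\otimes\beta-\beta\otimes\alpha$, the invariance conditions (for a Lorentzian world sheet) $$\mathcal L_{\rho_a}g=\omega^b_a\vee\iota_{\rho_b}g+\phi^b_a\vee\theta_b,\qquad \iota_{\rho_a}H=d\theta_a-\omega^b_a\wedge\theta_b-\phi^b_a\wedge\iota_{\rho_b}g$$ hold. The connections $\nabla^\pm=\nabla^\omega\pm\phi$ on $D$ are $\nabla^+=\nabla^D+T$ and $\nabla^-=\nabla^D+T-2\,(\theta^*-\rho)^{-1}\circ(\mathring\nabla\rho-\rho T)$. (3) Put $\mathfrak a=\tfrac12(\theta^*+\rho):D\to TM$, and let $\nabla^D=\nabla^{LC}$ be the connection on $D$ that corresponds to $\mathring\nabla$ under $\mathfrak a$. The image $\widetilde D$ is parametrized by some $\mathcal O$, and for any such $\mathcal O$ one has $\rho(e)\oplus\theta(e)=u_{\mathcal O}(\mathfrak a(e))$ for $e\in D$. In terms of the parameter $\mathfrak a$ (a section $\mathfrak a=\mathfrak a^k\partial_k$ of $TM$ in place of a section of $D$;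 $j$ is the 1-form index) the coefficients of (2) are $$\omega^i_{jk}=\Gamma^i_{jk}+\tfrac12(\mathcal O^{-1})^i{}_m\mathring\nabla_j\mathcal O^m{}_k+\tfrac18(\mathrm{id}+\mathcal O^{-1})^i{}_mH^m{}_{jl}(\mathrm{id}-\mathcal O)^l{}_k,$$ $$\phi^i_{jk}=-\tfrac12(\mathcal O^{-1})^i{}_m\mathring\nabla_j\mathcal O^m{}_k+\tfrac18(\mathrm{id}-\mathcal O^{-1})^i{}_mH^m{}_{jl}(\mathrm{id}-\mathcal O)^l{}_k,$$ with $\Gamma^i_{jk}$ the Christoffel symbols of $g$. With $\mathcal K^i_{jk}=\tfrac12H^i{}_{jl}(\mathrm{id}-\mathcal O)^l{}_k$ this means $\nabla^+=\nabla^{LC}+\tfrac12\mathcal K$ and $\nabla^-=\nabla^{LC}-\mathcal O^{-1}\big(\mathring\nabla(\mathrm{id}-\mathcal O)-\tfrac12\mathcal K\big)$. (4) If $D$ is parametrized by $\mathcal O$, $\widetilde D$ by $\widetilde{\mathcal O}$, and $(\rho\oplus\theta)(u_{\mathcal O}(\mathfrak a))=u_{\widetilde{\mathcal O}}(\mathfrak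 a)$ for all $\mathfrak a\in TM$ (for instance if $\rho\oplus\theta$ is the inclusion of $D$, and $\widetilde{\mathcal O}=\mathcal O$), then the map $\mathfrak a$ of (3) is the inverse of $u_{\mathcal O}:TM\to D$. -/

import Mathlib

open Bundle Manifold
open scoped ContDiff Topology

namespace DiracSigma

noncomputable section

section Fields

variable {E : Type*} [NormedAddCommGroup E] [NormedSpace ℝ E]
  {M : Type*} [TopologicalSpace M] [ChartedSpace E M]

/-- The tangent space of the manifold `M` at `x`. -/
abbrev TM (E : Type*) [NormedAddCommGroup E] [NormedSpace ℝ E]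
    {M : Type*} [TopologicalSpace M] [ChartedSpace E M] (x : M) : Type _ :=
  TangentSpace 𝓘(ℝ, E) x

/-- The cotangent space of `M` at `x`. -/
abbrev TsM (E : Type*) [NormedAddCommGroup E] [NormedSpace ℝ E]
    {M : Type*} [TopologicalSpace M] [ChartedSpace E M] (x : M) : Type _ :=
  TM E x →L[ℝ] ℝ

/-- The fibre of the generalized tangent bundle `TM ⊕ T*M` at `x`. -/
abbrev GenTM (E : Type*) [NormedAddCommGroup E] [NormedSpace ℝ E]
    {M : Type*} [TopologicalSpace M] [ChartedSpace E M] (x : M) : Type _ :=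
  TM E x × TsM E x

variable [IsManifold 𝓘(ℝ, E) ∞ M]

/-- `f` is a smooth function on a neighbourhood of `x`. -/
def SmoothFun (E : Type*) [NormedAddCommGroup E] [NormedSpace ℝ E]
    {M : Type*} [TopologicalSpace M] [ChartedSpace E M] (f : M → ℝ) (x : M) : Prop :=
  ∀ᶠ y in 𝓝 x, ContMDiffAt 𝓘(ℝ, E) 𝓘(ℝ, ℝ) ∞ f y

/-- `X` is a smooth vector field on a neighbourhood of `x`. -/
def SmoothVec (X : ∀ x : M, TM E x) (x : M) : Prop :=
  ∀ᶠ y in 𝓝 x, ContMDiffAt 𝓘(ℝ, E) (𝓘(ℝ, E).prod 𝓘(ℝ, E)) ∞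
    (fun z ↦ TotalSpace.mk' E (E := fun z : M ↦ TangentSpace 𝓘(ℝ, E) z) z (X z)) y

/-- `α` is a smooth 1-form on a neighbourhood of `x`. -/
def SmoothForm (α : ∀ x : M, TsM E x) (x : M) : Prop :=
  ∀ᶠ y in 𝓝 x, ContMDiffAt 𝓘(ℝ, E) (𝓘(ℝ, E).prod 𝓘(ℝ, E →L[ℝ] ℝ)) ∞
    (fun z ↦ TotalSpace.mk' (E →L[ℝ] ℝ)
      (E := fun z : M ↦ TangentSpace 𝓘(ℝ, E) z →L[ℝ] Bundle.Trivial M ℝ z) z (α z)) y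

/-- The derivative `V(f)` at `x`. -/
def dirDeriv (V : ∀ x : M, TM E x) (f : M → ℝ) (x : M) : ℝ :=
  mvfderiv 𝓘(ℝ, E) f x (V x)

/-- The Lie bracket of vector fields. -/
def lieBr (V W : ∀ x : M, TM E x) (x : M) : TM E x :=
  VectorField.mlieBracket 𝓘(ℝ, E) V W x

/-- `(dα)(X, Y) = X(α(Y)) - Y(α(X)) - α([X, Y])`; in coordinates `∂ᵢ αⱼ - ∂ⱼ αᵢ`. -/
def extD (α : ∀ x : M, TsM E x) (X Y : ∀ x : M, TM E x) (x : M) : ℝ :=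
  dirDeriv X (fun y ↦ α y (Y y)) x - dirDeriv Y (fun y ↦ α y (X y)) x - α x (lieBr X Y x)

/-- `(L_V α)(Y) = V(α(Y)) - α([V, Y])`. -/
def lieForm (V : ∀ x : M, TM E x) (α : ∀ x : M, TsM E x) (Y : ∀ x : M, TM E x) (x : M) : ℝ :=
  dirDeriv V (fun y ↦ α y (Y y)) x - α x (lieBr V Y x)

variable (E M) in
/-- A smooth differential 3-form on `M`. -/
structure ThreeForm where
  /-- The value at `x` on three tangent vectors. -/
  val : ∀ x : M, TM E x →L[ℝ] TM E x →L[ℝ] TM E x →L[ℝ] ℝ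
  alt_left : ∀ x u v, val x u u v = 0
  alt_right : ∀ x u v, val x u v v = 0
  smooth : ∀ (x : M) (X Y Z : ∀ x : M, TM E x), SmoothVec X x → SmoothVec Y x → SmoothVec Z x →
    SmoothFun E (fun y ↦ val y (X y) (Y y) (Z y)) x

/-- `dH = 0`, with `dH` evaluated on four local vector fields. -/
def ThreeForm.IsClosedForm (H : ThreeForm E M) : Prop :=
  ∀ (x : M) (X Y Z W : ∀ x : M, TM E x),
    SmoothVec X x → SmoothVec Y x → SmoothVec Z x → SmoothVec W x →
    dirDeriv X (fun y ↦ H.val y (Y y) (Z y) (W y)) x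
      - dirDeriv Y (fun y ↦ H.val y (X y) (Z y) (W y)) x
      + dirDeriv Z (fun y ↦ H.val y (X y) (Y y) (W y)) x
      - dirDeriv W (fun y ↦ H.val y (X y) (Y y) (Z y)) x
      - H.val x (lieBr X Y x) (Z x) (W x)
      + H.val x (lieBr X Z x) (Y x) (W x)
      - H.val x (lieBr X W x) (Y x) (Z x)
      - H.val x (lieBr Y Z x) (X x) (W x)
      + H.val x (lieBr Y W x) (X x) (Z x)
      - H.val x (lieBr Z W x) (X x) (Y x) = 0

/-- A smooth local section of the family `D` of subspaces of `TM ⊕ T*M`, near `x`. -/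
def SmoothSec {D : ∀ x : M, Submodule ℝ (GenTM E x)} (σ : ∀ x, D x) (x : M) : Prop :=
  SmoothVec (fun y ↦ (σ y).1.1) x ∧ SmoothForm (fun y ↦ (σ y).1.2) x

/-- The 1-form part of the `H`-twisted Courant bracket of `v ⊕ η` and `w ⊕ ζ`, evaluated on `Y`:
`L_v ζ - L_w η - ½ d(ζ(v) - η(w)) + H(v, w, ·)`. The last term is `- ι_v ι_w H`. -/
def courantForm (H : ThreeForm E M) (v : ∀ x : M, TM E x) (η : ∀ x : M, TsM E x)
    (w : ∀ x : M, TM E x) (ζ : ∀ x : M, TsM E x) (Y : ∀ x : M, TM E x) (x : M) : ℝ :=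
  lieForm v ζ Y x - lieForm w η Y x
    - (1 / 2) * dirDeriv Y (fun y ↦ ζ y (v y) - η y (w y)) x
    + H.val x (v x) (w x) (Y x)

/-- `D ⊂ TM ⊕ T*M` is a Dirac structure of the `H`-twisted standard Courant algebroid:
a smooth subbundle of rank `dim M` (half the rank of `TM ⊕ T*M`) that is isotropic and closed
under the `H`-twisted Courant bracket. -/
structure IsDirac (H : ThreeForm E M) (D : ∀ x : M, Submodule ℝ (GenTM E x)) : Prop where
  subbundle : ∀ x₀ : M, ∃ e : Fin (Module.finrank ℝ E) → ∀ x, D x,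
    (∀ a, SmoothSec (e a) x₀) ∧
    ∀ᶠ y in 𝓝 x₀, LinearIndependent ℝ (fun a ↦ e a y) ∧
      Submodule.span ℝ (Set.range fun a ↦ e a y) = ⊤
  isotropic : ∀ (x : M) (ξ ζ : D x), ζ.1.2 ξ.1.1 + ξ.1.2 ζ.1.1 = 0
  involutive : ∀ (x : M) (ξ ζ : ∀ x, D x), SmoothSec ξ x → SmoothSec ζ x →
    ∃ τ : D x, τ.1.1 = lieBr (fun y ↦ (ξ y).1.1) (fun y ↦ (ζ y).1.1) x ∧
      ∀ Y : ∀ x : M, TM E x, SmoothVec Y x →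
        τ.1.2 (Y x) = courantForm H (fun y ↦ (ξ y).1.1) (fun y ↦ (ξ y).1.2)
          (fun y ↦ (ζ y).1.1) (fun y ↦ (ζ y).1.2) Y x

/-- The image of `D` under `ρ ⊕ θ : D → TM ⊕ T*M`. -/
def image {D : ∀ x : M, Submodule ℝ (GenTM E x)}
    (ρ : ∀ x, D x →ₗ[ℝ] TM E x) (θ : ∀ x, D x →ₗ[ℝ] TsM E x) (x : M) :
    Submodule ℝ (GenTM E x) :=
  LinearMap.range ((ρ x).prod (θ x))

/-- An operator from sections of `D` to `D`-valued 1-forms is a (smooth) connection on `D`: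
it is additive, obeys the Leibniz rule and preserves smoothness.
`nabla σ x w` stands for `(∇_w σ)(x)`. -/
structure IsConnection {D : ∀ x : M, Submodule ℝ (GenTM E x)}
    (nabla : (∀ x, D x) → ∀ x : M, TM E x →ₗ[ℝ] D x) : Prop where
  add : ∀ (x : M) (σ τ : ∀ x, D x), SmoothSec σ x → SmoothSec τ x →
    nabla (σ + τ) x = nabla σ x + nabla τ x
  leibniz : ∀ (x : M) (f : M → ℝ) (σ : ∀ x, D x), SmoothFun E f x → SmoothSec σ x →
    ∀ X : ∀ x : M, TM E x,
      nabla (fun y ↦ f y • σ y) x (X x) = f x • nabla σ x (X x) + dirDeriv X f x • σ x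
  smooth : ∀ (x : M) (σ : ∀ x, D x) (X : ∀ x : M, TM E x), SmoothSec σ x → SmoothVec X x →
    SmoothSec (fun y ↦ nabla σ y (X y)) x

/-- A section of `T*M ⊗ End D` (given by its values at all points) is smooth. -/
def SmoothEndForm {D : ∀ x : M, Submodule ℝ (GenTM E x)}
    (A : ∀ x : M, D x →ₗ[ℝ] TM E x →ₗ[ℝ] D x) : Prop :=
  ∀ (x : M) (σ : ∀ x, D x) (X : ∀ x : M, TM E x), SmoothSec σ x → SmoothVec X x →
    SmoothSec (fun y ↦ A y (σ y) (X y)) x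

end Fields

section Metric

variable {E : Type*} [NormedAddCommGroup E] [NormedSpace ℝ E] [FiniteDimensional ℝ E]
  {M : Type*} [TopologicalSpace M] [ChartedSpace E M] [IsManifold 𝓘(ℝ, E) ∞ M]

variable (E M) in
/-- A smooth Riemannian metric on `M`; `g.inner x v w` is `g(v, w)` at `x`. -/
abbrev Metric : Type _ :=
  ContMDiffRiemannianMetric 𝓘(ℝ, E) ∞ E (fun x : M ↦ TangentSpace 𝓘(ℝ, E) x)

variable (g : Metric E M)

/-- The isomorphism `v ↦ v* = g(v, ·)` from tangent to cotangent vectors. -/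
def flat (x : M) : TM E x ≃ₗ[ℝ] TsM E x :=
  haveI : FiniteDimensional ℝ (TM E x) := inferInstanceAs (FiniteDimensional ℝ E)
  LinearEquiv.ofBijective (g.inner x).toLinearMap
    (by
      have hinj : Function.Injective (g.inner x).toLinearMap := by
        intro v w hvw
        by_contra hne
        have hpos := g.pos x (v - w) (sub_ne_zero.mpr hne)
        have hzero : g.inner x (v - w) = 0 := by
          rw [map_sub, sub_eq_zero]
          exact hvw
        rw [hzero] at hpos
        exact lt_irrefl _ hpos
      have hrank : Module.finrank ℝ (TM E x) = Module.finrank ℝ (TsM E x) := by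
        have h1 : Module.finrank ℝ (E →ₗ[ℝ] ℝ) = Module.finrank ℝ (E →L[ℝ] ℝ) :=
          (LinearMap.toContinuousLinearMap (𝕜 := ℝ) (E := E) (F' := ℝ)).finrank_eq
        have h2 : Module.finrank ℝ (E →ₗ[ℝ] ℝ) = Module.finrank ℝ E :=
          Subspace.dual_finrank_eq
        exact h2.symm.trans h1
      have : FiniteDimensional ℝ (TsM E x) :=
        inferInstanceAs (FiniteDimensional ℝ (E →L[ℝ] ℝ))
      exact ⟨hinj, (LinearMap.injective_iff_surjective_of_finrank_eq_finrank hrank).mp hinj⟩)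

/-- `η ↦ η*`, raising the index with the metric: `g(η*, w) = η(w)`. -/
def sharp (x : M) : TsM E x ≃ₗ[ℝ] TM E x := (flat g x).symm

/-- `(L_V g)(X, Y) = V(g(X, Y)) - g([V, X], Y) - g(X, [V, Y])`. -/
def lieMetric (V X Y : ∀ x : M, TM E x) (x : M) : ℝ :=
  dirDeriv V (fun y ↦ g.inner y (X y) (Y y)) x
    - g.inner x (lieBr V X x) (Y x) - g.inner x (X x) (lieBr V Y x)

/-- `nab` is the Levi-Civita connection of `g`: the smooth torsion-free connection on `TM`
that is compatible with `g`. `nab Y x (X x)` stands for `(∇_X Y)(x)`. -/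
structure IsLeviCivita
    (nab : CovariantDerivative 𝓘(ℝ, E) E (fun x : M ↦ TangentSpace 𝓘(ℝ, E) x)) : Prop where
  smooth : ∀ (x : M) (X Y : ∀ x : M, TM E x), SmoothVec X x → SmoothVec Y x →
    SmoothVec (fun y ↦ nab Y y (X y)) x
  metric : ∀ (x : M) (X Y Z : ∀ x : M, TM E x), SmoothVec X x → SmoothVec Y x → SmoothVec Z x →
    dirDeriv X (fun y ↦ g.inner y (Y y) (Z y)) x =
      g.inner x (nab Y x (X x)) (Z x) + g.inner x (Y x) (nab Z x (X x))
  torsion_free : ∀ (x : M) (X Y : ∀ x : M, TM E x), SmoothVec X x → SmoothVec Y x →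
    nab Y x (X x) - nab X x (Y x) = lieBr X Y x

/-- The element `(id - O) a ⊕ ((id + O) a)*` of `TM ⊕ T*M`. -/
def param (O : ∀ x : M, TM E x ≃ₗ[ℝ] TM E x) (x : M) (a : TM E x) : GenTM E x :=
  (a - O x a, flat g x (a + O x a))

/-- `D` is parametrized by the smooth field `O` of `g`-orthogonal operators on `TM`:
`D = {(id - O) a ⊕ ((id + O) a)* | a ∈ TM}`. -/
structure IsGraph (O : ∀ x : M, TM E x ≃ₗ[ℝ] TM E x)
    (D : ∀ x : M, Submodule ℝ (GenTM E x)) : Prop where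
  orthogonal : ∀ (x : M) (v w : TM E x), g.inner x (O x v) (O x w) = g.inner x v w
  smooth : ∀ (x : M) (X : ∀ x : M, TM E x), SmoothVec X x → SmoothVec (fun y ↦ O y (X y)) x
  graph : ∀ (x : M) (ξ : GenTM E x), ξ ∈ D x ↔ ∃ a : TM E x, ξ = param g O x a

section Connections

variable {D : ∀ x : M, Submodule ℝ (GenTM E x)}
  (nab : CovariantDerivative 𝓘(ℝ, E) E (fun x : M ↦ TangentSpace 𝓘(ℝ, E) x))
  (nablaD : (∀ x, D x) → ∀ x : M, TM E x →ₗ[ℝ] D x)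

/-- The covariant derivative of `A : D → TM` with respect to `nablaD` on `D` and `nab` on `TM`,
evaluated on the section `σ`: `(∇_w A)(σ) = ∇_w (A σ) - A (∇_w σ)`. -/
def covHom (A : ∀ x, D x →ₗ[ℝ] TM E x) (σ : ∀ x, D x) (x : M) (w : TM E x) : TM E x :=
  nab (fun y ↦ A y (σ y)) x w - A x (nablaD σ x w)

/-- The covariant derivative of `B : TM → TM` on the vector field `a`:
`(∇_w B)(a) = ∇_w (B a) - B (∇_w a)`. -/
def covEnd (B : ∀ x : M, TM E x →ₗ[ℝ] TM E x) (a : ∀ x : M, TM E x) (x : M) (w : TM E x) :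
    TM E x :=
  nab (fun y ↦ B y (a y)) x w - B x (nab a x w)

/-- The connection on `D` that corresponds to `nab` under an isomorphism `A : D → TM`. -/
def transport (A : ∀ x, D x ≃ₗ[ℝ] TM E x) (σ : ∀ x, D x) (x : M) : TM E x →ₗ[ℝ] D x :=
  (A x).symm.toLinearMap ∘ₗ (nab (fun y ↦ A y (σ y)) x).toLinearMap

/-- `∇^ω = ∇^D - φ + T`, that is `ω = Γ - φ + T` for the coefficients in a frame of `D`. -/
def omegaConn (T φ : ∀ x : M, D x →ₗ[ℝ] TM E x →ₗ[ℝ] D x) (σ : ∀ x, D x) (x : M) :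
    TM E x →ₗ[ℝ] D x where
  toFun w := nablaD σ x w - φ x (σ x) w + T x (σ x) w
  map_add' u v := by
    rw [map_add, map_add, map_add]
    abel
  map_smul' c v := by
    rw [map_smul, map_smul, map_smul, RingHom.id_apply]
    module

/-- `∇^+ = ∇^ω + φ`. -/
def plusConn (nablaO : (∀ x, D x) → ∀ x : M, TM E x →ₗ[ℝ] D x)
    (φ : ∀ x : M, D x →ₗ[ℝ] TM E x →ₗ[ℝ] D x) (σ : ∀ x, D x) (x : M) : TM E x →ₗ[ℝ] D x where
  toFun w := nablaO σ x w + φ x (σ x) w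
  map_add' u v := by
    rw [map_add, map_add]
    abel
  map_smul' c v := by
    rw [map_smul, map_smul, RingHom.id_apply]
    module

/-- `∇^- = ∇^ω - φ`. -/
def minusConn (nablaO : (∀ x, D x) → ∀ x : M, TM E x →ₗ[ℝ] D x)
    (φ : ∀ x : M, D x →ₗ[ℝ] TM E x →ₗ[ℝ] D x) (σ : ∀ x, D x) (x : M) : TM E x →ₗ[ℝ] D x where
  toFun w := nablaO σ x w - φ x (σ x) w
  map_add' u v := by
    rw [map_add, map_add]
    abel
  map_smul' c v := by
    rw [map_smul, map_smul, RingHom.id_apply]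
    module

variable (H : ThreeForm E M) (ρ : ∀ x, D x →ₗ[ℝ] TM E x) (θ : ∀ x, D x →ₗ[ℝ] TsM E x)

/-- `T` is given by `T = (θ* + ρ)⁻¹ (∇(θ* + ρ) - ½ ρ H)`, where `P = θ* + ρ`. The vector
`H(ρ σ, w, ·)*` has the components `H^k_{l i} (ρ σ)^l w^i`. -/
def IsTorsionCoeff (P : ∀ x, D x ≃ₗ[ℝ] TM E x)
    (T : ∀ x : M, D x →ₗ[ℝ] TM E x →ₗ[ℝ] D x) : Prop :=
  ∀ (x : M) (σ : ∀ x, D x), SmoothSec σ x → ∀ w : TM E x,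
    T x (σ x) w = (P x).symm
      (covHom nab nablaD (fun y ↦ (P y).toLinearMap) σ x w
        - (1 / 2 : ℝ) • sharp g x (H.val x (ρ x (σ x)) w))

/-- `φ` is given by `φ = (θ* - ρ)⁻¹ (∇ρ - ρ T)`, where `N = θ* - ρ`. -/
def IsPhiCoeff (N : ∀ x, D x ≃ₗ[ℝ] TM E x)
    (T φ : ∀ x : M, D x →ₗ[ℝ] TM E x →ₗ[ℝ] D x) : Prop :=
  ∀ (x : M) (σ : ∀ x, D x), SmoothSec σ x → ∀ w : TM E x,
    φ x (σ x) w = (N x).symm (covHom nab nablaD ρ σ x w - ρ x (T x (σ x) w))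

/-- The condition `L_{ρ_a} g = ω_a^b ∨ ι_{ρ_b} g + φ_a^b ∨ θ_b`, where
`α ∨ β = α ⊗ β + β ⊗ α`, evaluated on `(X, Y)`. Here `σ = e_a` is an arbitrary local section of
`D`, and `∇^ω e_a = ω_a^b ⊗ e_b`, `φ(e_a) = φ_a^b ⊗ e_b`. -/
def InvarianceMetric (nablaO : (∀ x, D x) → ∀ x : M, TM E x →ₗ[ℝ] D x)
    (φ : ∀ x : M, D x →ₗ[ℝ] TM E x →ₗ[ℝ] D x) : Prop :=
  ∀ (x : M) (σ : ∀ x, D x) (X Y : ∀ x : M, TM E x),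
    SmoothSec σ x → SmoothVec X x → SmoothVec Y x →
    lieMetric g (fun y ↦ ρ y (σ y)) X Y x =
      (g.inner x (ρ x (nablaO σ x (X x))) (Y x) + g.inner x (ρ x (nablaO σ x (Y x))) (X x))
      + (θ x (φ x (σ x) (X x)) (Y x) + θ x (φ x (σ x) (Y x)) (X x))

/-- The condition `ι_{ρ_a} H = dθ_a - ω_a^b ∧ θ_b - φ_a^b ∧ ι_{ρ_b} g` (Lorentzian world sheet),
where `α ∧ β = α ⊗ β - β ⊗ α`, evaluated on `(X, Y)`, with `σ = e_a` as above. -/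
def InvarianceForm (nablaO : (∀ x, D x) → ∀ x : M, TM E x →ₗ[ℝ] D x)
    (φ : ∀ x : M, D x →ₗ[ℝ] TM E x →ₗ[ℝ] D x) : Prop :=
  ∀ (x : M) (σ : ∀ x, D x) (X Y : ∀ x : M, TM E x),
    SmoothSec σ x → SmoothVec X x → SmoothVec Y x →
    H.val x (ρ x (σ x)) (X x) (Y x) =
      extD (fun y ↦ θ y (σ y)) X Y x
      - (θ x (nablaO σ x (X x)) (Y x) - θ x (nablaO σ x (Y x)) (X x))
      - (g.inner x (ρ x (φ x (σ x) (X x))) (Y x) - g.inner x (ρ x (φ x (σ x) (Y x))) (X x))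

end Connections

end Metric
end
end DiracSigma

/-!
The sum `ρ ⊕ θ` maps `D` isomorphically onto its image, because both have rank `dim M`, and the
image is isotropic, so `g(θ*e, ρe') + g(ρe, θ*e') = 0`. Hence
`g((θ* ± ρ)e, (θ* ± ρ)e') = g(θ*e, θ*e') + g(ρe, ρe')` for both signs (`inner_sharp_add`,
`inner_sharp_sub`). This form is positive definite on `D`, so `P = θ* + ρ` and `N = θ* - ρ` are
isomorphisms `D → TM`, and `N P⁻¹` is orthogonal; it is the operator that parametrizes the image
(`isGraph_image`).

Smoothness of the inverses is a matter of frames: the coefficients of a smooth vector field in a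
smooth local frame are smooth by Cramer's rule for the Gram matrix (`exists_smooth_coeff`). The same
lemma, with a cut-off by an indicator function, shows that operations on sections of `D` that are
linear over the smooth functions are tensors (`exists_linearMap_of_tensorial`); this turns the
formulas for `T` and `φ`, which involve covariant derivatives of sections, into bundle maps.

Multiplying the formulas for `T` and `φ` by `P` and `N` gives
`ρ ∘ ∇^ω + θ* ∘ φ = ∇ ∘ ρ` and `θ* ∘ ∇^ω + ρ ∘ φ = ∇ ∘ θ* - ½ H(ρ, ·, ·)*`
(`rho_omegaConn_add`, `theta_omegaConn_add`). Since the Levi-Civita connection `∇` is metric and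
torsion-free, `L_V g` is the symmetrization of `∇V` and `dα` the antisymmetrization of `∇α*`
(`lieMetric_eq`, `extD_eq`), and the two invariance conditions are the symmetrization of the first
identity and the antisymmetrization of the second.

If `D` carries the connection transported from `TM` by `½ P`, then `P` is parallel and `T` reduces
to its `H`-term; expressing `ρ` and `N` through `P` and the orthogonal operator gives the remaining
formulas (`omegaConn_transport_formulas`).
-/

namespace DiracSigma

/-! ### Smooth functions, vector fields, forms and sections -/

section Smooth

variable {E : Type*} [NormedAddCommGroup E] [NormedSpace ℝ E]
  {M : Type*} [TopologicalSpace M] [ChartedSpace E M]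

theorem SmoothFun.congr {f h : M → ℝ} {x : M} (hf : SmoothFun E f x)
    (hfh : ∀ᶠ y in 𝓝 x, f y = h y) : SmoothFun E h x := by
  filter_upwards [hf, hfh.eventually_nhds] with y hy hy'
  exact hy.congr_of_eventuallyEq (hy'.mono fun _ hz ↦ hz.symm)

theorem smoothFun_const (c : ℝ) (x : M) : SmoothFun E (fun _ ↦ c) x :=
  Filter.Eventually.of_forall fun _ ↦ contMDiffAt_const

theorem SmoothFun.mul {f h : M → ℝ} {x : M} (hf : SmoothFun E f x) (hh : SmoothFun E h x) :
    SmoothFun E (fun y ↦ f y * h y) x := by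
  filter_upwards [hf, hh] with y hy hy'
  exact hy.mul hy'

theorem SmoothFun.sum {ι : Type*} {s : Finset ι} {f : ι → M → ℝ} {x : M}
    (hf : ∀ i, SmoothFun E (f i) x) : SmoothFun E (fun y ↦ ∑ i ∈ s, f i y) x := by
  have h : ∀ᶠ y in 𝓝 x, ∀ i ∈ s, ContMDiffAt 𝓘(ℝ, E) 𝓘(ℝ, ℝ) ∞ (f i) y :=
    (Filter.eventually_all_finset s).2 fun i _ ↦ hf i
  filter_upwards [h] with y hy
  exact contMDiffAt_finsetSum hy

theorem SmoothFun.prod {ι : Type*} {s : Finset ι} {f : ι → M → ℝ} {x : M}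
    (hf : ∀ i, SmoothFun E (f i) x) : SmoothFun E (fun y ↦ ∏ i ∈ s, f i y) x := by
  have h : ∀ᶠ y in 𝓝 x, ∀ i ∈ s, ContMDiffAt 𝓘(ℝ, E) 𝓘(ℝ, ℝ) ∞ (f i) y :=
    (Filter.eventually_all_finset s).2 fun i _ ↦ hf i
  filter_upwards [h] with y hy
  exact contMDiffAt_finsetProd hy

theorem SmoothFun.inv {f : M → ℝ} {x : M} (hf : SmoothFun E f x)
    (h0 : ∀ᶠ y in 𝓝 x, f y ≠ 0) : SmoothFun E (fun y ↦ (f y)⁻¹) x := by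
  filter_upwards [hf, h0] with y hy hy0
  exact (contDiffAt_inv ℝ hy0).comp_contMDiffAt hy

theorem SmoothFun.det {ι : Type*} [Fintype ι] [DecidableEq ι] {G : M → Matrix ι ι ℝ} {x : M}
    (hG : ∀ i j, SmoothFun E (fun y ↦ G y i j) x) : SmoothFun E (fun y ↦ (G y).det) x := by
  simp only [Matrix.det_apply']
  exact .sum fun p ↦ (smoothFun_const _ x).mul (.prod fun i ↦ hG _ _)

theorem SmoothFun.mdifferentiableAt {f : M → ℝ} {x : M} (hf : SmoothFun E f x) :
    MDifferentiableAt 𝓘(ℝ, E) 𝓘(ℝ, ℝ) f x :=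
  hf.self_of_nhds.mdifferentiableAt (by simp)

variable [IsManifold 𝓘(ℝ, E) ∞ M]

theorem SmoothVec.congr {X Y : ∀ x : M, TM E x} {x : M} (hX : SmoothVec X x)
    (hXY : ∀ᶠ y in 𝓝 x, X y = Y y) : SmoothVec Y x := by
  filter_upwards [hX, hXY.eventually_nhds] with y hy hy'
  exact hy.congr_of_eventuallyEq (hy'.mono fun z hz ↦ by simp only [hz])

theorem SmoothVec.add {X Y : ∀ x : M, TM E x} {x : M} (hX : SmoothVec X x)
    (hY : SmoothVec Y x) : SmoothVec (fun y ↦ X y + Y y) x := by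
  filter_upwards [hX, hY] with y hy hy'
  exact hy.add_section hy'

theorem SmoothVec.sub {X Y : ∀ x : M, TM E x} {x : M} (hX : SmoothVec X x)
    (hY : SmoothVec Y x) : SmoothVec (fun y ↦ X y - Y y) x := by
  filter_upwards [hX, hY] with y hy hy'
  exact hy.sub_section hy'

theorem SmoothVec.smul {X : ∀ x : M, TM E x} {f : M → ℝ} {x : M} (hf : SmoothFun E f x)
    (hX : SmoothVec X x) : SmoothVec (fun y ↦ f y • X y) x := by
  filter_upwards [hX, hf] with y hy hy'
  exact hy'.smul_section hy

theorem SmoothVec.sum {ι : Type*} {s : Finset ι} {X : ι → ∀ x : M, TM E x} {x : M}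
    (hX : ∀ i, SmoothVec (X i) x) : SmoothVec (fun y ↦ ∑ i ∈ s, X i y) x := by
  have h : ∀ᶠ y in 𝓝 x, ∀ i ∈ s, ContMDiffAt 𝓘(ℝ, E) (𝓘(ℝ, E).prod 𝓘(ℝ, E)) ∞
      (fun z ↦ TotalSpace.mk' E (E := fun z : M ↦ TangentSpace 𝓘(ℝ, E) z) z (X i z)) y :=
    (Filter.eventually_all_finset s).2 fun i _ ↦ hX i
  filter_upwards [h] with y hy
  exact ContMDiffAt.sum_section hy

theorem SmoothVec.mdifferentiableAt {X : ∀ x : M, TM E x} {x : M} (hX : SmoothVec X x) :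
    MDifferentiableAt 𝓘(ℝ, E) (𝓘(ℝ, E).prod 𝓘(ℝ, E))
      (fun z ↦ TotalSpace.mk' E (E := fun z : M ↦ TangentSpace 𝓘(ℝ, E) z) z (X z)) x :=
  hX.self_of_nhds.mdifferentiableAt (by simp)

theorem SmoothForm.congr {α β : ∀ x : M, TsM E x} {x : M} (hα : SmoothForm α x)
    (h : ∀ᶠ y in 𝓝 x, α y = β y) : SmoothForm β x := by
  filter_upwards [hα, h.eventually_nhds] with y hy hy'
  exact hy.congr_of_eventuallyEq (hy'.mono fun z hz ↦ by simp only [hz])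

theorem SmoothForm.add {α β : ∀ x : M, TsM E x} {x : M} (hα : SmoothForm α x)
    (hβ : SmoothForm β x) : SmoothForm (fun y ↦ α y + β y) x := by
  filter_upwards [hα, hβ] with y hy hy'
  exact hy.add_section hy'

theorem SmoothForm.smul {α : ∀ x : M, TsM E x} {f : M → ℝ} {x : M} (hf : SmoothFun E f x)
    (hα : SmoothForm α x) : SmoothForm (fun y ↦ f y • α y) x := by
  filter_upwards [hα, hf] with y hy hy'
  exact hy'.smul_section hy

theorem SmoothForm.apply {α : ∀ x : M, TsM E x} {X : ∀ x : M, TM E x} {x : M}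
    (hα : SmoothForm α x) (hX : SmoothVec X x) : SmoothFun E (fun y ↦ α y (X y)) x := by
  filter_upwards [hα, hX] with y hy hy'
  have := hy.clm_bundle_apply hy'
  simpa [contMDiffAt_section] using this

section Sections

variable {D : ∀ x : M, Submodule ℝ (GenTM E x)}

theorem SmoothSec.eventually {σ : ∀ x, D x} {x : M} (hσ : SmoothSec σ x) :
    ∀ᶠ y in 𝓝 x, SmoothSec σ y :=
  (Filter.Eventually.eventually_nhds hσ.1).and (Filter.Eventually.eventually_nhds hσ.2)

theorem SmoothSec.congr {σ τ : ∀ x, D x} {x : M} (hσ : SmoothSec σ x)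
    (h : ∀ᶠ y in 𝓝 x, σ y = τ y) : SmoothSec τ x :=
  ⟨hσ.1.congr (h.mono fun _ hy ↦ by rw [hy]), hσ.2.congr (h.mono fun _ hy ↦ by rw [hy])⟩

theorem SmoothSec.add {σ τ : ∀ x, D x} {x : M} (hσ : SmoothSec σ x) (hτ : SmoothSec τ x) :
    SmoothSec (fun y ↦ σ y + τ y) x :=
  ⟨hσ.1.add hτ.1, hσ.2.add hτ.2⟩

theorem SmoothSec.smul {σ : ∀ x, D x} {f : M → ℝ} {x : M} (hf : SmoothFun E f x)
    (hσ : SmoothSec σ x) : SmoothSec (fun y ↦ f y • σ y) x :=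
  ⟨.smul hf hσ.1, .smul hf hσ.2⟩

theorem smoothSec_zero (x : M) : SmoothSec (fun y ↦ (0 : D y)) x :=
  ⟨.of_forall fun y ↦ contMDiff_zeroSection ℝ (fun z : M ↦ TangentSpace 𝓘(ℝ, E) z) y,
    .of_forall fun y ↦ contMDiff_zeroSection ℝ
      (fun z : M ↦ TangentSpace 𝓘(ℝ, E) z →L[ℝ] Bundle.Trivial M ℝ z) y⟩

theorem SmoothSec.sum {ι : Type*} {s : Finset ι} {σ : ι → ∀ x, D x} {x : M}
    (hσ : ∀ i, SmoothSec (σ i) x) : SmoothSec (fun y ↦ ∑ i ∈ s, σ i y) x := by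
  classical
  induction s using Finset.induction_on with
  | empty => simpa using smoothSec_zero x
  | insert i s hi ih => simpa [Finset.sum_insert hi] using (hσ i).add ih

end Sections

variable (E) in
theorem exists_frame_tangent [FiniteDimensional ℝ E] (x : M) :
    ∃ v : Fin (Module.finrank ℝ E) → ∀ x : M, TM E x, (∀ a, SmoothVec (v a) x) ∧
      ∀ᶠ y in 𝓝 x, LinearIndependent ℝ (fun a ↦ v a y) ∧
        Submodule.span ℝ (Set.range fun a ↦ v a y) = ⊤ := by
  let b := Module.finBasis ℝ E
  let e := trivializationAt E (fun z : M ↦ TangentSpace 𝓘(ℝ, E) z) x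
  have hx : e.baseSet ∈ 𝓝 x := e.open_baseSet.mem_nhds (mem_baseSet_trivializationAt E _ x)
  have hf := e.isLocalFrameOn_localFrame_baseSet 𝓘(ℝ, E) ∞ b
  refine ⟨e.localFrame b, fun a ↦ ?_, ?_⟩
  · filter_upwards [hx] with y hy
    exact hf.contMDiffAt e.open_baseSet hy a
  · filter_upwards [hx] with y hy
    exact ⟨hf.linearIndependent hy, top_le_iff.1 (hf.generating hy)⟩

end Smooth

/-! ### Local frames and tensoriality -/

section Frames

variable {E : Type*} [NormedAddCommGroup E] [NormedSpace ℝ E]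
  {M : Type*} [TopologicalSpace M] [ChartedSpace E M] [IsManifold 𝓘(ℝ, E) ∞ M]

theorem SmoothVec.inner (g : Metric E M) {X Y : ∀ x : M, TM E x} {x : M} (hX : SmoothVec X x)
    (hY : SmoothVec Y x) : SmoothFun E (fun y ↦ g.inner y (X y) (Y y)) x := by
  filter_upwards [hX, hY] with y hy hy'
  have := ContMDiffAt.clm_bundle_apply₂ (F₁ := E) (F₂ := E) (F₃ := ℝ)
    (E₁ := fun z : M ↦ TangentSpace 𝓘(ℝ, E) z) (E₂ := fun z : M ↦ TangentSpace 𝓘(ℝ, E) z)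
    (E₃ := Bundle.Trivial M ℝ) (b := fun z : M ↦ z) (g.contMDiff y) hy hy'
  simpa [contMDiffAt_section] using this

theorem inner_self_eq_zero (g : Metric E M) {x : M} {v : TM E x} : g.inner x v v = 0 ↔ v = 0 := by
  refine ⟨fun h ↦ ?_, fun h ↦ by simp [h]⟩
  by_contra hv
  exact (g.pos x v hv).ne' h

theorem IsDirac.nonempty_basis {H : ThreeForm E M} {D : ∀ x : M, Submodule ℝ (GenTM E x)}
    (hD : IsDirac H D) (x : M) :
    Nonempty (Module.Basis (Fin (Module.finrank ℝ E)) ℝ (D x)) := by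
  obtain ⟨e, -, he⟩ := hD.subbundle x
  obtain ⟨h1, h2⟩ := he.self_of_nhds
  exact ⟨Module.Basis.mk h1 h2.ge⟩

/-- The coefficients of `Z` in a local frame solve a linear system whose matrix is the Gram matrix
of the frame, so by Cramer's rule they are smooth as soon as the inner products of `Z` with the
frame are. -/
theorem exists_smooth_coeff (g : Metric E M) {ι : Type*} [Fintype ι]
    {v : ι → ∀ x : M, TM E x} {Z : ∀ x : M, TM E x} {x : M}
    (hv : ∀ a, SmoothVec (v a) x)
    (hb : ∀ᶠ y in 𝓝 x, LinearIndependent ℝ (fun a ↦ v a y) ∧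
      Submodule.span ℝ (Set.range fun a ↦ v a y) = ⊤)
    (hZ : ∀ a, SmoothFun E (fun y ↦ g.inner y (Z y) (v a y)) x) :
    ∃ c : ι → M → ℝ, (∀ a, SmoothFun E (c a) x) ∧ ∀ᶠ y in 𝓝 x, Z y = ∑ a, c a y • v a y := by
  classical
  let G : M → Matrix ι ι ℝ := fun y ↦ Matrix.of fun a b ↦ g.inner y (v b y) (v a y)
  have hG : ∀ a b, SmoothFun E (fun y ↦ G y a b) x := fun a b ↦ (hv b).inner g (hv a)
  have hmul : ∀ y (d : ι → ℝ) a, (G y).mulVec d a = g.inner y (∑ b, d b • v b y) (v a y) := by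
    intro y d a
    simp [G, Matrix.mulVec, dotProduct, mul_comm]
  have hdet : ∀ᶠ y in 𝓝 x, (G y).det ≠ 0 := by
    filter_upwards [hb] with y hy h0
    obtain ⟨u, hu, hGu⟩ := Matrix.exists_mulVec_eq_zero_iff.2 h0
    refine hu (funext fun a ↦ Fintype.linearIndependent_iff.1 hy.1 u ?_ a)
    rw [← inner_self_eq_zero g]
    conv_lhs => rw [map_sum]
    refine Finset.sum_eq_zero fun a _ ↦ ?_
    rw [map_smul, ← hmul, hGu, Pi.zero_apply, smul_zero]
  let β : M → ι → ℝ := fun y a ↦ g.inner y (Z y) (v a y)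
  refine ⟨fun a y ↦ ((G y).updateCol a (β y)).det * (G y).det⁻¹, fun a ↦ ?_, ?_⟩
  · refine .mul (.det fun i j ↦ ?_) (.inv (.det hG) hdet)
    rcases eq_or_ne j a with rfl | hj
    · simpa using hZ i
    · simpa [hj] using hG i j
  · filter_upwards [hb, hdet] with y hy hd
    let B := Module.Basis.mk hy.1 hy.2.ge
    have hB : Z y = ∑ a, B.repr (Z y) a • v a y := by
      conv_lhs => rw [← B.sum_repr (Z y)]
      simp [B]
    have hβ : β y = (G y).mulVec (B.repr (Z y)) := by
      funext a
      rw [hmul, ← hB]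
    conv_lhs => rw [hB]
    refine Finset.sum_congr rfl fun a _ ↦ ?_
    congr 1
    rw [← Matrix.cramer_apply, hβ, Matrix.cramer_eq_adjugate_mulVec, Matrix.mulVec_mulVec,
      Matrix.adjugate_mul, Matrix.smul_mulVec, Matrix.one_mulVec, Pi.smul_apply, smul_eq_mul]
    field_simp

variable [FiniteDimensional ℝ E] (g : Metric E M)

@[simp]
theorem flat_apply (x : M) (v w : TM E x) : flat g x v w = g.inner x v w := rfl

@[simp]
theorem inner_sharp (x : M) (α : TsM E x) (w : TM E x) : g.inner x (sharp g x α) w = α w := by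
  rw [← flat_apply, sharp, LinearEquiv.apply_symm_apply]

/-- A vector field is smooth if its inner products with all smooth vector fields are. -/
theorem smoothVec_of_inner {Z : ∀ x : M, TM E x} {x : M}
    (hZ : ∀ Y : ∀ x : M, TM E x, SmoothVec Y x → SmoothFun E (fun y ↦ g.inner y (Z y) (Y y)) x) :
    SmoothVec Z x := by
  obtain ⟨v, hv, hb⟩ := exists_frame_tangent E x
  obtain ⟨c, hc, hZc⟩ := exists_smooth_coeff g hv hb fun a ↦ hZ _ (hv a)
  exact (SmoothVec.sum fun a ↦ .smul (hc a) (hv a)).congr (hZc.mono fun _ hy ↦ hy.symm)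

theorem smoothVec_sharp {α : ∀ x : M, TsM E x} {x : M}
    (hα : ∀ Y : ∀ x : M, TM E x, SmoothVec Y x → SmoothFun E (fun y ↦ α y (Y y)) x) :
    SmoothVec (fun y ↦ sharp g y (α y)) x :=
  smoothVec_of_inner g fun Y hY ↦ by simpa using hα Y hY

end Frames

section Sections

variable {E : Type*} [NormedAddCommGroup E] [NormedSpace ℝ E]
  {M : Type*} [TopologicalSpace M] [ChartedSpace E M] [IsManifold 𝓘(ℝ, E) ∞ M]
  {D : ∀ x : M, Submodule ℝ (GenTM E x)} {H : ThreeForm E M}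

/-- A smooth bundle isomorphism `D → TM` maps a smooth frame of `D` to a smooth frame of `TM`, so
the coefficients with respect to a smooth frame of `D` are smooth, too. -/
theorem exists_smooth_coeff_sec (g : Metric E M)
    {Q : ∀ x, D x ≃ₗ[ℝ] TM E x}
    (hQ : ∀ (x : M) (σ : ∀ x, D x), SmoothSec σ x → SmoothVec (fun y ↦ Q y (σ y)) x)
    {ι : Type*} [Fintype ι] {e : ι → ∀ x, D x} {x : M} (he : ∀ a, SmoothSec (e a) x)
    (hb : ∀ᶠ y in 𝓝 x, LinearIndependent ℝ (fun a ↦ e a y) ∧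
      Submodule.span ℝ (Set.range fun a ↦ e a y) = ⊤)
    {σ : ∀ x, D x} (hσ : SmoothVec (fun y ↦ Q y (σ y)) x) :
    ∃ c : ι → M → ℝ, (∀ a, SmoothFun E (c a) x) ∧ ∀ᶠ y in 𝓝 x, σ y = ∑ a, c a y • e a y := by
  have hQb : ∀ᶠ y in 𝓝 x, LinearIndependent ℝ (fun a ↦ Q y (e a y)) ∧
      Submodule.span ℝ (Set.range fun a ↦ Q y (e a y)) = ⊤ := by
    filter_upwards [hb] with y hy
    let B := (Module.Basis.mk hy.1 hy.2.ge).map (Q y)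
    have hB : (fun a ↦ Q y (e a y)) = B := by
      funext a
      simp [B]
    rw [hB]
    exact ⟨B.linearIndependent, B.span_eq⟩
  obtain ⟨c, hc, hZ⟩ := exists_smooth_coeff g (v := fun a y ↦ Q y (e a y)) (Z := fun y ↦ Q y (σ y))
    (fun a ↦ hQ x (e a) (he a)) hQb fun a ↦ hσ.inner g (hQ x (e a) (he a))
  refine ⟨c, hc, hZ.mono fun y hy ↦ (Q y).injective ?_⟩
  simpa [map_sum] using hy

theorem smoothSec_symm_apply (g : Metric E M) (hD : IsDirac H D)
    {Q : ∀ x, D x ≃ₗ[ℝ] TM E x}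
    (hQ : ∀ (x : M) (σ : ∀ x, D x), SmoothSec σ x → SmoothVec (fun y ↦ Q y (σ y)) x)
    {x : M} {X : ∀ x : M, TM E x} (hX : SmoothVec X x) :
    SmoothSec (fun y ↦ (Q y).symm (X y)) x := by
  obtain ⟨e, he, hb⟩ := hD.subbundle x
  obtain ⟨c, hc, hσ⟩ := exists_smooth_coeff_sec g hQ he hb (σ := fun y ↦ (Q y).symm (X y))
    (by simpa using hX)
  exact (SmoothSec.sum fun a ↦ .smul (hc a) (he a)).congr (hσ.mono fun _ hy ↦ hy.symm)

/-- An operation on local sections of `D` that is linear over the smooth functions depends only on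
the value at the point, and linearly so. -/
theorem exists_linearMap_of_tensorial (g : Metric E M) (hD : IsDirac H D)
    {Q : ∀ x, D x ≃ₗ[ℝ] TM E x}
    (hQ : ∀ (x : M) (σ : ∀ x, D x), SmoothSec σ x → SmoothVec (fun y ↦ Q y (σ y)) x)
    {W : Type*} [AddCommGroup W] [Module ℝ W] {x : M} (F : (∀ x, D x) → W)
    (hadd : ∀ σ τ : ∀ x, D x, SmoothSec σ x → SmoothSec τ x → F (σ + τ) = F σ + F τ)
    (hsmul : ∀ (f : M → ℝ) (σ : ∀ x, D x), SmoothFun E f x → SmoothSec σ x →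
      F (fun y ↦ f y • σ y) = f x • F σ) :
    ∃ L : D x →ₗ[ℝ] W, ∀ σ : ∀ x, D x, SmoothSec σ x → L (σ x) = F σ := by
  classical
  obtain ⟨e, he, hb⟩ := hD.subbundle x
  obtain ⟨h1, h2⟩ := hb.self_of_nhds
  let B := Module.Basis.mk h1 h2.ge
  refine ⟨B.constr ℝ fun a ↦ F (e a), fun σ hσ ↦ ?_⟩
  obtain ⟨c, hc, hσc⟩ := exists_smooth_coeff_sec g hQ he hb (hQ x σ hσ)
  let τ : ∀ x, D x := fun y ↦ ∑ a, c a y • e a y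
  -- Multiplication by the indicator function of the set where `σ = τ` shows that `F σ = F τ`.
  have hlocal : F σ = F τ := by
    let ψ : M → ℝ := fun y ↦ if σ y = τ y then 1 else 0
    have hψ : SmoothFun E ψ x :=
      (smoothFun_const 1 x).congr (hσc.mono fun y hy ↦ (if_pos hy).symm)
    have hψx : ψ x = 1 := if_pos hσc.self_of_nhds
    have hτ : SmoothSec τ x := .sum fun a ↦ .smul (hc a) (he a)
    have hψστ : (fun y ↦ ψ y • σ y) = fun y ↦ ψ y • τ y := by
      funext y
      by_cases hy : σ y = τ y
      · rw [hy]
      · simp [ψ, hy]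
    have h := hsmul ψ σ hψ hσ
    rwa [hψστ, hsmul ψ τ hψ hτ, hψx, one_smul, one_smul, eq_comm] at h
  have hzero : F 0 = 0 := by
    have h := hsmul (fun _ ↦ 0) 0 (smoothFun_const 0 x) (smoothSec_zero x)
    rw [zero_smul] at h
    rw [← h]
    congr 1
    funext y
    exact (zero_smul ℝ _).symm
  have hsum : ∀ s : Finset (Fin (Module.finrank ℝ E)),
      F (fun y ↦ ∑ a ∈ s, c a y • e a y) = ∑ a ∈ s, c a x • F (e a) := by
    intro s
    induction s using Finset.induction_on with
    | empty => simpa only [Finset.sum_empty] using! hzero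
    | insert a s ha ih =>
      simp only [Finset.sum_insert ha]
      rw [← ih, ← hsmul _ _ (hc a) (he a)]
      exact hadd _ _ (.smul (hc a) (he a)) (.sum fun a ↦ .smul (hc a) (he a))
  rw [hlocal, hsum, hσc.self_of_nhds, map_sum]
  refine Finset.sum_congr rfl fun a _ ↦ ?_
  rw [map_smul]
  congr 1
  rw [← B.constr_basis ℝ (fun a ↦ F (e a)) a]
  simp [B]

end Sections

/-! ### Invertibility of `θ* ± ρ` -/

section Equiv

variable {ι V W : Type*} [Fintype ι] [AddCommMonoid V] [Module ℝ V] [AddCommMonoid W] [Module ℝ W]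

/-- Stated over additive monoids, so that no additive group structure on the fibres of a family of
subspaces has to be matched with their module structure. -/
theorem injective_of_surjective_of_basis (b : Module.Basis ι ℝ V) (c : Module.Basis ι ℝ W)
    {f : V →ₗ[ℝ] W} (hf : Function.Surjective f) : Function.Injective f := by
  let F : (ι → ℝ) →ₗ[ℝ] (ι → ℝ) :=
    c.equivFun.toLinearMap ∘ₗ f ∘ₗ b.equivFun.symm.toLinearMap
  have hF : Function.Surjective F :=
    c.equivFun.surjective.comp (hf.comp b.equivFun.symm.surjective)
  have h := LinearMap.injective_iff_surjective.2 hF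
  intro v w hvw
  refine b.equivFun.injective (h ?_)
  simp [F, hvw]

theorem exists_equiv_of_basis (b : Module.Basis ι ℝ V) (c : Module.Basis ι ℝ W)
    (f : V →ₗ[ℝ] W) (hf : ∀ v, f v = 0 → v = 0) : ∃ P : V ≃ₗ[ℝ] W, ∀ v, P v = f v := by
  let F : (ι → ℝ) →ₗ[ℝ] (ι → ℝ) :=
    c.equivFun.toLinearMap ∘ₗ f ∘ₗ b.equivFun.symm.toLinearMap
  have hF : Function.Injective F := by
    refine (injective_iff_map_eq_zero F).2 fun u hu ↦ ?_
    have h0 := hf (b.equivFun.symm u) (c.equivFun.map_eq_zero_iff.1 hu)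
    exact b.equivFun.symm.map_eq_zero_iff.1 h0
  refine ⟨b.equivFun.trans ((LinearEquiv.ofInjectiveEndo F hF).trans c.equivFun.symm), fun v ↦ ?_⟩
  simp only [LinearEquiv.trans_apply, LinearEquiv.coe_ofInjectiveEndo, LinearEquiv.symm_apply_eq]
  simp [F]

end Equiv

section Pointwise

variable {E : Type*} [NormedAddCommGroup E] [NormedSpace ℝ E]
  {M : Type*} [TopologicalSpace M] [ChartedSpace E M] [IsManifold 𝓘(ℝ, E) ∞ M]
  {H : ThreeForm E M} {D : ∀ x : M, Submodule ℝ (GenTM E x)}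
  {ρ : ∀ x, D x →ₗ[ℝ] TM E x} {θ : ∀ x, D x →ₗ[ℝ] TsM E x}

/-- `ρ ⊕ θ` is injective, since `D` and its image have the same rank `dim M`. -/
theorem eq_zero_of_prod_eq_zero (hD : IsDirac H D) (hD' : IsDirac H (image ρ θ)) (x : M) {e : D x}
    (h1 : ρ x e = 0) (h2 : θ x e = 0) : e = 0 := by
  obtain ⟨b⟩ := hD.nonempty_basis x
  obtain ⟨c⟩ : Nonempty (Module.Basis (Fin (Module.finrank ℝ E)) ℝ
      (LinearMap.range ((ρ x).prod (θ x)))) := hD'.nonempty_basis x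
  have h := injective_of_surjective_of_basis b c
    (f := ((ρ x).prod (θ x)).rangeRestrict) (LinearMap.surjective_rangeRestrict _)
  have h0 : ((ρ x).prod (θ x)).rangeRestrict e = 0 := Subtype.ext (Prod.ext h1 h2)
  refine h ?_
  rw [h0, map_zero]

theorem isotropic_image (hD' : IsDirac H (image ρ θ)) (x : M) (e f : D x) :
    θ x f (ρ x e) + θ x e (ρ x f) = 0 :=
  hD'.isotropic x ⟨(ρ x e, θ x e), e, rfl⟩ ⟨(ρ x f, θ x f), f, rfl⟩

variable [FiniteDimensional ℝ E] {g : Metric E M}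

/-- The mixed terms cancel because the image is isotropic. -/
theorem inner_sharp_add (hD' : IsDirac H (image ρ θ)) (x : M) (e f : D x) :
    g.inner x (sharp g x (θ x e) + ρ x e) (sharp g x (θ x f) + ρ x f) =
      g.inner x (sharp g x (θ x e)) (sharp g x (θ x f)) + g.inner x (ρ x e) (ρ x f) := by
  have h := isotropic_image hD' x e f
  simp only [map_add, add_apply, inner_sharp, g.symm x (ρ x e) (sharp g x _)]
  linarith

theorem inner_sharp_sub (hD' : IsDirac H (image ρ θ)) (x : M) (e f : D x) :
    g.inner x (sharp g x (θ x e) - ρ x e) (sharp g x (θ x f) - ρ x f) =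
      g.inner x (sharp g x (θ x e)) (sharp g x (θ x f)) + g.inner x (ρ x e) (ρ x f) := by
  have h := isotropic_image hD' x e f
  simp only [map_sub, sub_apply, inner_sharp, g.symm x (ρ x e) (sharp g x _)]
  linarith

theorem eq_zero_of_inner_add (hD : IsDirac H D) (hD' : IsDirac H (image ρ θ)) (x : M) {e : D x}
    (h : g.inner x (sharp g x (θ x e)) (sharp g x (θ x e)) + g.inner x (ρ x e) (ρ x e) = 0) :
    e = 0 := by
  have hpos : ∀ v : TM E x, 0 ≤ g.inner x v v := fun v ↦ by
    rcases eq_or_ne v 0 with rfl | hv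
    · simp
    · exact (g.pos x v hv).le
  have h1 := (inner_self_eq_zero g).1 (by linarith [hpos (sharp g x (θ x e)), hpos (ρ x e)] :
    g.inner x (sharp g x (θ x e)) (sharp g x (θ x e)) = 0)
  have h2 := (inner_self_eq_zero g).1 (by linarith [hpos (sharp g x (θ x e)), hpos (ρ x e)] :
    g.inner x (ρ x e) (ρ x e) = 0)
  exact eq_zero_of_prod_eq_zero hD hD' x h2 (by simpa using h1)

/-- A fibrewise injective map `D → TM` is an isomorphism, since the ranks agree. -/
theorem exists_equiv_of_injective (hD : IsDirac H D) (Q : ∀ x, D x →ₗ[ℝ] TM E x)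
    (hQ : ∀ x e, Q x e = 0 → e = 0) : ∃ P : ∀ x, D x ≃ₗ[ℝ] TM E x, ∀ x e, P x e = Q x e := by
  have h : ∀ x, ∃ P : D x ≃ₗ[ℝ] TM E x, ∀ e, P e = Q x e := fun x ↦ by
    obtain ⟨b⟩ := hD.nonempty_basis x
    obtain ⟨v, -, hv⟩ := exists_frame_tangent E x
    obtain ⟨h1, h2⟩ := hv.self_of_nhds
    exact exists_equiv_of_basis b (Module.Basis.mk h1 h2.ge) (Q x) (hQ x)
  choose P hP using h
  exact ⟨P, hP⟩

theorem exists_sharp_add_equiv (g : Metric E M) (hD : IsDirac H D)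
    (hD' : IsDirac H (image ρ θ)) :
    ∃ P : ∀ x, D x ≃ₗ[ℝ] TM E x, ∀ x e, P x e = sharp g x (θ x e) + ρ x e :=
  exists_equiv_of_injective hD (fun x ↦ (sharp g x).toLinearMap ∘ₗ θ x + ρ x) fun x e he ↦ by
    refine eq_zero_of_inner_add (g := g) hD hD' x ?_
    rw [← inner_sharp_add hD']
    exact (inner_self_eq_zero g).2 he

theorem exists_sharp_sub_equiv (g : Metric E M) (hD : IsDirac H D)
    (hD' : IsDirac H (image ρ θ)) :
    ∃ N : ∀ x, D x ≃ₗ[ℝ] TM E x, ∀ x e, N x e = sharp g x (θ x e) - ρ x e :=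
  exists_equiv_of_injective hD (fun x ↦ (sharp g x).toLinearMap ∘ₗ θ x - ρ x) fun x e he ↦ by
    refine eq_zero_of_inner_add (g := g) hD hD' x ?_
    rw [← inner_sharp_sub hD']
    exact (inner_self_eq_zero g).2 he

/-- The parameter `a` is recovered from `v ⊕ η = (id - O) a ⊕ ((id + O) a)*` as
`a = ½ (η* + v)`. -/
theorem eq_half_of_param {O : ∀ x : M, TM E x ≃ₗ[ℝ] TM E x} {x : M} {v : TM E x} {η : TsM E x}
    {a : TM E x} (h : (v, η) = param g O x a) : a = (1 / 2 : ℝ) • (sharp g x η + v) := by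
  obtain ⟨rfl, rfl⟩ := Prod.ext_iff.1 h
  simp only [param, sharp, LinearEquiv.symm_apply_apply]
  module

end Pointwise

/-! ### Covariant derivatives -/

section Connections

variable {E : Type*} [NormedAddCommGroup E] [NormedSpace ℝ E]
  {M : Type*} [TopologicalSpace M] [ChartedSpace E M] {D : ∀ x : M, Submodule ℝ (GenTM E x)}

theorem omegaConn_add (nablaD : (∀ x, D x) → ∀ x : M, TM E x →ₗ[ℝ] D x)
    (T φ : ∀ x : M, D x →ₗ[ℝ] TM E x →ₗ[ℝ] D x) (σ : ∀ x, D x) (x : M) (w : TM E x) :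
    omegaConn nablaD T φ σ x w + φ x (σ x) w = nablaD σ x w + T x (σ x) w := by
  change nablaD σ x w - φ x (σ x) w + T x (σ x) w + φ x (σ x) w = _
  abel

end Connections

section Derivatives

variable {E : Type*} [NormedAddCommGroup E] [NormedSpace ℝ E]
  {M : Type*} [TopologicalSpace M] [ChartedSpace E M] [IsManifold 𝓘(ℝ, E) ∞ M]
  {g : Metric E M} {H : ThreeForm E M} {D : ∀ x : M, Submodule ℝ (GenTM E x)}
  {nab : CovariantDerivative 𝓘(ℝ, E) E (fun x : M ↦ TangentSpace 𝓘(ℝ, E) x)}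
  {nablaD : (∀ x, D x) → ∀ x : M, TM E x →ₗ[ℝ] D x}

theorem nab_add {X Y : ∀ x : M, TM E x} {x : M} (hX : SmoothVec X x) (hY : SmoothVec Y x)
    (w : TM E x) : nab (fun y ↦ X y + Y y) x w = nab X x w + nab Y x w :=
  congr($(nab.isCovariantDerivativeOnUniv.add hX.mdifferentiableAt hY.mdifferentiableAt) w)

theorem nab_smul {X : ∀ x : M, TM E x} {f : M → ℝ} {x : M} (hf : SmoothFun E f x)
    (hX : SmoothVec X x) (w : TM E x) :
    nab (fun y ↦ f y • X y) x w = f x • nab X x w + mvfderiv 𝓘(ℝ, E) f x w • X x :=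
  congr($(nab.isCovariantDerivativeOnUniv.leibniz hX.mdifferentiableAt hf.mdifferentiableAt) w)

theorem nab_const_smul {X : ∀ x : M, TM E x} {x : M} (hX : SmoothVec X x) (c : ℝ)
    (w : TM E x) : nab (fun y ↦ c • X y) x w = c • nab X x w :=
  congr($(nab.isCovariantDerivativeOnUniv.smul_const c hX.mdifferentiableAt) w)

theorem nab_sub {X Y : ∀ x : M, TM E x} {x : M} (hX : SmoothVec X x) (hY : SmoothVec Y x)
    (w : TM E x) : nab (fun y ↦ X y - Y y) x w = nab X x w - nab Y x w := by
  have h := nab_add (nab := nab) (hX.sub hY) hY w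
  simp only [sub_add_cancel] at h
  rw [h, add_sub_cancel_right]

theorem IsConnection.leibniz_apply (hD : IsConnection nablaD) {x : M} {f : M → ℝ}
    {σ : ∀ x, D x} (hf : SmoothFun E f x) (hσ : SmoothSec σ x) (w : TM E x) :
    nablaD (fun y ↦ f y • σ y) x w = f x • nablaD σ x w + mvfderiv 𝓘(ℝ, E) f x w • σ x := by
  classical
  simpa [dirDeriv] using hD.leibniz x f σ hf hσ (Function.update 0 x w)

/-- The covariant derivative of a bundle map `A : D → TM` is a tensor. -/
theorem exists_covHom_tensor (g : Metric E M) (hD : IsDirac H D) {Q : ∀ x, D x ≃ₗ[ℝ] TM E x}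
    (hQ : ∀ (x : M) (σ : ∀ x, D x), SmoothSec σ x → SmoothVec (fun y ↦ Q y (σ y)) x)
    (hnablaD : IsConnection nablaD) {A : ∀ x, D x →ₗ[ℝ] TM E x}
    (hA : ∀ (x : M) (σ : ∀ x, D x), SmoothSec σ x → SmoothVec (fun y ↦ A y (σ y)) x) :
    ∃ C : ∀ x, D x →ₗ[ℝ] TM E x →ₗ[ℝ] TM E x, ∀ (x : M) (σ : ∀ x, D x), SmoothSec σ x →
      ∀ w, C x (σ x) w = covHom nab nablaD A σ x w := by
  have h : ∀ x : M, ∃ L : D x →ₗ[ℝ] TM E x →ₗ[ℝ] TM E x, ∀ σ : ∀ x, D x, SmoothSec σ x →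
      L (σ x) = (nab (fun y ↦ A y (σ y)) x).toLinearMap - A x ∘ₗ nablaD σ x := by
    intro x
    refine exists_linearMap_of_tensorial g hD hQ _ (fun σ τ hσ hτ ↦ ?_) fun f σ hf hσ ↦ ?_
    · ext w
      have h1 := nab_add (nab := nab) (hA x σ hσ) (hA x τ hτ) w
      have h2 := hnablaD.add x σ τ hσ hτ
      simp only [Pi.add_apply, map_add] at h1 ⊢
      simp [h1, h2]
      abel
    · ext w
      have h1 := nab_smul (nab := nab) hf (hA x σ hσ) w
      have h2 := hnablaD.leibniz_apply hf hσ w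
      simp only [map_smul]
      simp [h1, h2, smul_sub]
  choose C hC using h
  exact ⟨C, fun x σ hσ w ↦ by rw [hC x σ hσ]; rfl⟩

theorem smoothVec_covHom (hnab : IsLeviCivita g nab) (hnablaD : IsConnection nablaD)
    {A : ∀ x, D x →ₗ[ℝ] TM E x}
    (hA : ∀ (x : M) (σ : ∀ x, D x), SmoothSec σ x → SmoothVec (fun y ↦ A y (σ y)) x)
    {x : M} {σ : ∀ x, D x} {X : ∀ x : M, TM E x} (hσ : SmoothSec σ x) (hX : SmoothVec X x) :
    SmoothVec (fun y ↦ covHom nab nablaD A σ y (X y)) x :=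
  (hnab.smooth x X _ hX (hA x σ hσ)).sub (hA x _ (hnablaD.smooth x σ X hσ hX))

/-- A connection stays a connection when a section of `T*M ⊗ End D` is added. The result is a
family `nabla` with a pointwise hypothesis, so that the lemma applies to `omegaConn`, `plusConn` and
`minusConn`. -/
theorem IsConnection.add_endForm (hnablaD : IsConnection nablaD)
    {A : ∀ x : M, D x →ₗ[ℝ] TM E x →ₗ[ℝ] D x} (hA : SmoothEndForm A)
    {nabla : (∀ x, D x) → ∀ x : M, TM E x →ₗ[ℝ] D x}
    (h : ∀ σ x w, nabla σ x w = nablaD σ x w + A x (σ x) w) : IsConnection nabla where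
  add x σ τ hσ hτ := by
    ext1 w
    rw [LinearMap.add_apply, h, h, h, hnablaD.add x σ τ hσ hτ, Pi.add_apply, map_add,
      LinearMap.add_apply, LinearMap.add_apply]
    abel
  leibniz x f σ hf hσ X := by
    rw [h, h, hnablaD.leibniz x f σ hf hσ, map_smul, LinearMap.smul_apply]
    module
  smooth x σ X hσ hX := by
    simp only [h]
    exact (hnablaD.smooth x σ X hσ hX).add (hA x σ X hσ hX)

theorem SmoothEndForm.add {A B : ∀ x : M, D x →ₗ[ℝ] TM E x →ₗ[ℝ] D x} (hA : SmoothEndForm A)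
    (hB : SmoothEndForm B) : SmoothEndForm (fun x ↦ A x + B x) :=
  fun x σ X hσ hX ↦ (hA x σ X hσ hX).add (hB x σ X hσ hX)

theorem SmoothEndForm.const_smul {A : ∀ x : M, D x →ₗ[ℝ] TM E x →ₗ[ℝ] D x} (c : ℝ)
    (hA : SmoothEndForm A) : SmoothEndForm (fun x ↦ c • A x) :=
  fun x σ X hσ hX ↦ .smul (smoothFun_const c x) (hA x σ X hσ hX)

theorem isConnection_transport (hnab : IsLeviCivita g nab) {A : ∀ x, D x ≃ₗ[ℝ] TM E x}
    (hA : ∀ (x : M) (σ : ∀ x, D x), SmoothSec σ x → SmoothVec (fun y ↦ A y (σ y)) x)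
    (hA' : ∀ (x : M) (X : ∀ x : M, TM E x), SmoothVec X x →
      SmoothSec (fun y ↦ (A y).symm (X y)) x) : IsConnection (transport nab A) where
  add x σ τ hσ hτ := by
    ext1 w
    have h := nab_add (nab := nab) (hA x σ hσ) (hA x τ hτ) w
    simp [transport, h]
  leibniz x f σ hf hσ X := by
    have h := nab_smul (nab := nab) hf (hA x σ hσ) (X x)
    simp [transport, h, dirDeriv]
  smooth x σ X hσ hX := hA' x _ (hnab.smooth x X _ hX (hA x σ hσ))

/-- `L_V g` is the symmetrization of `∇V`. -/
theorem lieMetric_eq (hnab : IsLeviCivita g nab) {x : M} {V X Y : ∀ x : M, TM E x}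
    (hV : SmoothVec V x) (hX : SmoothVec X x) (hY : SmoothVec Y x) :
    lieMetric g V X Y x = g.inner x (nab V x (X x)) (Y x) + g.inner x (nab V x (Y x)) (X x) := by
  rw [lieMetric, hnab.metric x V X Y hV hX hY, ← hnab.torsion_free x V X hV hX,
    ← hnab.torsion_free x V Y hV hY, g.symm x (nab V x (Y x))]
  simp only [map_sub, sub_apply]
  ring

/-- `dα` is the antisymmetrization of `∇α*`. -/
theorem extD_eq [FiniteDimensional ℝ E] (hnab : IsLeviCivita g nab) {x : M} {α : ∀ x : M, TsM E x}
    {X Y : ∀ x : M, TM E x} (hα : SmoothVec (fun y ↦ sharp g y (α y)) x) (hX : SmoothVec X x)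
    (hY : SmoothVec Y x) :
    extD α X Y x = g.inner x (nab (fun y ↦ sharp g y (α y)) x (X x)) (Y x)
      - g.inner x (nab (fun y ↦ sharp g y (α y)) x (Y x)) (X x) := by
  have h1 := hnab.metric x X _ Y hX hα hY
  have h2 := hnab.metric x Y _ X hY hα hX
  simp only [inner_sharp] at h1 h2
  rw [extD, h1, h2, ← hnab.torsion_free x X Y hX hY, map_sub]
  ring

end Derivatives

/-! ### The invariance conditions -/

section Invariance

variable {E : Type*} [NormedAddCommGroup E] [NormedSpace ℝ E]
  {M : Type*} [TopologicalSpace M] [ChartedSpace E M] [IsManifold 𝓘(ℝ, E) ∞ M]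
  {H : ThreeForm E M} {D : ∀ x : M, Submodule ℝ (GenTM E x)}
  {nab : CovariantDerivative 𝓘(ℝ, E) E (fun x : M ↦ TangentSpace 𝓘(ℝ, E) x)}
  {nablaD : (∀ x, D x) → ∀ x : M, TM E x →ₗ[ℝ] D x}
  {ρ : ∀ x, D x →ₗ[ℝ] TM E x} {θ : ∀ x, D x →ₗ[ℝ] TsM E x} {P N : ∀ x, D x ≃ₗ[ℝ] TM E x}
  {T φ : ∀ x : M, D x →ₗ[ℝ] TM E x →ₗ[ℝ] D x}

theorem ThreeForm.add_left (H : ThreeForm E M) (x : M) (u v w : TM E x) :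
    H.val x (u + v) w = H.val x u w + H.val x v w :=
  congr($((H.val x).toLinearMap.map_add u v) w)

theorem ThreeForm.smul_left (H : ThreeForm E M) (x : M) (c : ℝ) (u w : TM E x) :
    H.val x (c • u) w = c • H.val x u w :=
  congr($((H.val x).toLinearMap.map_smul c u) w)

theorem ThreeForm.add_middle (H : ThreeForm E M) (x : M) (u v w : TM E x) :
    H.val x u (v + w) = H.val x u v + H.val x u w :=
  (H.val x u).toLinearMap.map_add v w

theorem ThreeForm.smul_middle (H : ThreeForm E M) (x : M) (c : ℝ) (u w : TM E x) :
    H.val x u (c • w) = c • H.val x u w :=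
  (H.val x u).toLinearMap.map_smul c w

theorem ThreeForm.swap_left (H : ThreeForm E M) (x : M) (u v : TM E x) :
    H.val x u v = -H.val x v u := by
  ext w
  have h := H.alt_left x (u + v) w
  rw [H.add_left, H.add_middle, H.add_middle] at h
  simp only [add_apply, H.alt_left, zero_add, add_zero] at h
  change _ = -(H.val x v u w)
  linarith

theorem ThreeForm.swap_right (H : ThreeForm E M) (x : M) (u v w : TM E x) :
    H.val x u v w = -H.val x u w v := by
  have h := H.alt_right x u (v + w)
  simp only [map_add, add_apply, H.alt_right, zero_add, add_zero] at h
  linarith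

/-- The formula for `φ` defines a bundle map, because the covariant derivative of `ρ` is a
tensor. -/
theorem exists_phiCoeff {g : Metric E M} (hnab : IsLeviCivita g nab) (hD : IsDirac H D)
    (hnablaD : IsConnection nablaD)
    (hρ : ∀ (x : M) (σ : ∀ x, D x), SmoothSec σ x → SmoothVec (fun y ↦ ρ y (σ y)) x)
    (hN : ∀ (x : M) (σ : ∀ x, D x), SmoothSec σ x → SmoothVec (fun y ↦ N y (σ y)) x)
    (hT : SmoothEndForm T) :
    ∃ φ : ∀ x : M, D x →ₗ[ℝ] TM E x →ₗ[ℝ] D x, SmoothEndForm φ ∧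
      IsPhiCoeff nab nablaD ρ N T φ := by
  obtain ⟨C, hC⟩ := exists_covHom_tensor (nab := nab) g hD hN hnablaD hρ
  let φ : ∀ x : M, D x →ₗ[ℝ] TM E x →ₗ[ℝ] D x := fun x ↦ LinearMap.mk₂ ℝ
    (fun e w ↦ (N x).symm (C x e w - ρ x (T x e w)))
    (fun e f w ↦ by
      rw [← map_add]
      congr 1
      simp only [map_add, LinearMap.add_apply]
      module)
    (fun c e w ↦ by
      rw [← map_smul (N x).symm c]
      congr 1
      simp only [map_smul, LinearMap.smul_apply]
      module)
    (fun e v w ↦ by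
      rw [← map_add]
      congr 1
      simp only [map_add]
      module)
    (fun c e w ↦ by
      rw [← map_smul (N x).symm c]
      congr 1
      simp only [map_smul]
      module)
  have hφ : IsPhiCoeff nab nablaD ρ N T φ := fun x σ hσ w ↦ by
    rw [← hC x σ hσ]
    rfl
  refine ⟨φ, fun x σ X hσ hX ↦ ?_, hφ⟩
  have h := smoothSec_symm_apply g hD hN
    ((smoothVec_covHom hnab hnablaD hρ hσ hX).sub (hρ x _ (hT x σ X hσ hX)))
  exact h.congr (hσ.eventually.mono fun y hy ↦ (hφ y σ hy (X y)).symm)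

variable [FiniteDimensional ℝ E] {g : Metric E M}

theorem smoothVec_sharp_threeForm (g : Metric E M) (H : ThreeForm E M) {x : M}
    {X Y : ∀ x : M, TM E x} (hX : SmoothVec X x) (hY : SmoothVec Y x) :
    SmoothVec (fun y ↦ sharp g y (H.val y (X y) (Y y))) x :=
  smoothVec_sharp g fun Z hZ ↦ H.smooth x X Y Z hX hY hZ

/-- The formula for `T` defines a bundle map, because the covariant derivative of `θ* + ρ` is a
tensor. -/
theorem exists_torsionCoeff (hnab : IsLeviCivita g nab) (hD : IsDirac H D)
    (hnablaD : IsConnection nablaD)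
    (hρ : ∀ (x : M) (σ : ∀ x, D x), SmoothSec σ x → SmoothVec (fun y ↦ ρ y (σ y)) x)
    (hP : ∀ (x : M) (σ : ∀ x, D x), SmoothSec σ x → SmoothVec (fun y ↦ P y (σ y)) x) :
    ∃ T : ∀ x : M, D x →ₗ[ℝ] TM E x →ₗ[ℝ] D x, SmoothEndForm T ∧
      IsTorsionCoeff g nab nablaD H ρ P T := by
  obtain ⟨C, hC⟩ := exists_covHom_tensor (nab := nab) g hD hP hnablaD
    (A := fun y ↦ (P y).toLinearMap) hP
  let T : ∀ x : M, D x →ₗ[ℝ] TM E x →ₗ[ℝ] D x := fun x ↦ LinearMap.mk₂ ℝ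
    (fun e w ↦ (P x).symm (C x e w - (1 / 2 : ℝ) • sharp g x (H.val x (ρ x e) w)))
    (fun e f w ↦ by
      rw [← map_add]
      congr 1
      rw [map_add, map_add, LinearMap.add_apply, H.add_left, map_add]
      module)
    (fun c e w ↦ by
      rw [← map_smul (P x).symm c]
      congr 1
      rw [map_smul, map_smul, LinearMap.smul_apply, H.smul_left, map_smul (sharp g x)]
      module)
    (fun e v w ↦ by
      rw [← map_add]
      congr 1
      rw [map_add, H.add_middle, map_add]
      module)
    (fun c e w ↦ by
      rw [← map_smul (P x).symm c]
      congr 1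
      rw [map_smul, H.smul_middle, map_smul (sharp g x)]
      module)
  have hT : IsTorsionCoeff g nab nablaD H ρ P T := fun x σ hσ w ↦ by
    rw [← hC x σ hσ]
    rfl
  refine ⟨T, fun x σ X hσ hX ↦ ?_, hT⟩
  have h := smoothSec_symm_apply g hD hP
    ((smoothVec_covHom hnab hnablaD (A := fun y ↦ (P y).toLinearMap) hP hσ hX).sub
      (.smul (smoothFun_const (1 / 2 : ℝ) x) (smoothVec_sharp_threeForm g H (hρ x σ hσ) hX)))
  exact h.congr (hσ.eventually.mono fun y hy ↦ (hT y σ hy (X y)).symm)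

/-- The defining equation of `φ` says `ρ ∘ ∇^ω + θ* ∘ φ = ∇ ∘ ρ`, whose symmetrization is the
condition on the metric. -/
theorem rho_omegaConn_add (hN : ∀ x e, N x e = sharp g x (θ x e) - ρ x e)
    (hφ : IsPhiCoeff nab nablaD ρ N T φ) {x : M} {σ : ∀ x, D x} (hσ : SmoothSec σ x)
    (w : TM E x) :
    ρ x (omegaConn nablaD T φ σ x w) + sharp g x (θ x (φ x (σ x) w)) =
      nab (fun y ↦ ρ y (σ y)) x w := by
  have h : N x (φ x (σ x) w) = covHom nab nablaD ρ σ x w - ρ x (T x (σ x) w) := by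
    rw [hφ x σ hσ w, LinearEquiv.apply_symm_apply]
  have h' := congr_arg (ρ x) (omegaConn_add nablaD T φ σ x w)
  rw [map_add, map_add] at h'
  rw [hN, covHom] at h
  rw [eq_sub_of_add_eq h', sub_eq_iff_eq_add.1 h]
  abel

/-- The defining equations of `T` and `φ` together say
`θ* ∘ ∇^ω + ρ ∘ φ = ∇ ∘ θ* - ½ H(ρ, ·, ·)*`, whose antisymmetrization is the condition on `H`. -/
theorem theta_omegaConn_add (hP : ∀ x e, P x e = sharp g x (θ x e) + ρ x e)
    (hN : ∀ x e, N x e = sharp g x (θ x e) - ρ x e)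
    (hρ : ∀ (x : M) (σ : ∀ x, D x), SmoothSec σ x → SmoothVec (fun y ↦ ρ y (σ y)) x)
    (hθ : ∀ (x : M) (σ : ∀ x, D x), SmoothSec σ x →
      SmoothVec (fun y ↦ sharp g y (θ y (σ y))) x)
    (hT : IsTorsionCoeff g nab nablaD H ρ P T) (hφ : IsPhiCoeff nab nablaD ρ N T φ)
    {x : M} {σ : ∀ x, D x} (hσ : SmoothSec σ x) (w : TM E x) :
    sharp g x (θ x (omegaConn nablaD T φ σ x w)) + ρ x (φ x (σ x) w) =
      nab (fun y ↦ sharp g y (θ y (σ y))) x w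
        - (1 / 2 : ℝ) • sharp g x (H.val x (ρ x (σ x)) w) := by
  have h1 : N x (φ x (σ x) w) = covHom nab nablaD ρ σ x w - ρ x (T x (σ x) w) := by
    rw [hφ x σ hσ w, LinearEquiv.apply_symm_apply]
  have h2 : P x (T x (σ x) w) = covHom nab nablaD (fun y ↦ (P y).toLinearMap) σ x w
      - (1 / 2 : ℝ) • sharp g x (H.val x (ρ x (σ x)) w) := by
    rw [hT x σ hσ w, LinearEquiv.apply_symm_apply]
  rw [hN, covHom] at h1
  simp only [covHom, LinearEquiv.coe_coe, hP] at h2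
  rw [nab_add (hθ x σ hσ) (hρ x σ hσ)] at h2
  have h' := congr_arg (fun e ↦ sharp g x (θ x e)) (omegaConn_add nablaD T φ σ x w)
  simp only [map_add] at h'
  rw [eq_sub_of_add_eq h', sub_eq_iff_eq_add.1 h1, eq_sub_of_add_eq h2]
  abel

theorem invarianceMetric (hnab : IsLeviCivita g nab)
    (hN : ∀ x e, N x e = sharp g x (θ x e) - ρ x e)
    (hρ : ∀ (x : M) (σ : ∀ x, D x), SmoothSec σ x → SmoothVec (fun y ↦ ρ y (σ y)) x)
    (hφ : IsPhiCoeff nab nablaD ρ N T φ) :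
    InvarianceMetric g ρ θ (omegaConn nablaD T φ) φ := by
  intro x σ X Y hσ hX hY
  rw [lieMetric_eq hnab (hρ x σ hσ) hX hY, ← rho_omegaConn_add hN hφ hσ,
    ← rho_omegaConn_add hN hφ hσ]
  simp only [map_add, add_apply, inner_sharp]
  ring

theorem invarianceForm (hnab : IsLeviCivita g nab)
    (hP : ∀ x e, P x e = sharp g x (θ x e) + ρ x e)
    (hN : ∀ x e, N x e = sharp g x (θ x e) - ρ x e)
    (hρ : ∀ (x : M) (σ : ∀ x, D x), SmoothSec σ x → SmoothVec (fun y ↦ ρ y (σ y)) x)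
    (hθ : ∀ (x : M) (σ : ∀ x, D x), SmoothSec σ x →
      SmoothVec (fun y ↦ sharp g y (θ y (σ y))) x)
    (hT : IsTorsionCoeff g nab nablaD H ρ P T) (hφ : IsPhiCoeff nab nablaD ρ N T φ) :
    InvarianceForm g H ρ θ (omegaConn nablaD T φ) φ := by
  intro x σ X Y hσ hX hY
  have h := fun w ↦ eq_add_of_sub_eq (theta_omegaConn_add hP hN hρ hθ hT hφ hσ w).symm
  rw [extD_eq hnab (hθ x σ hσ) hX hY, h, h]
  simp only [map_add, map_smul, add_apply, smul_apply, inner_sharp, smul_eq_mul]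
  rw [H.swap_right x _ (Y x) (X x)]
  ring

end Invariance

/-! ### The orthogonal operator of the image -/

section Orthogonal

variable {E : Type*} [NormedAddCommGroup E] [NormedSpace ℝ E] [FiniteDimensional ℝ E]
  {M : Type*} [TopologicalSpace M] [ChartedSpace E M] [IsManifold 𝓘(ℝ, E) ∞ M]
  {g : Metric E M} {H : ThreeForm E M} {D : ∀ x : M, Submodule ℝ (GenTM E x)}
  {nab : CovariantDerivative 𝓘(ℝ, E) E (fun x : M ↦ TangentSpace 𝓘(ℝ, E) x)}
  {ρ : ∀ x, D x →ₗ[ℝ] TM E x} {θ : ∀ x, D x →ₗ[ℝ] TsM E x} {P N A : ∀ x, D x ≃ₗ[ℝ] TM E x}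
  {T φ : ∀ x : M, D x →ₗ[ℝ] TM E x →ₗ[ℝ] D x} {O : ∀ x : M, TM E x ≃ₗ[ℝ] TM E x}

/-- The orthogonal operator of the image is the Cayley-type quotient `(θ* - ρ) (θ* + ρ)⁻¹`; it is
orthogonal since `θ* + ρ` and `θ* - ρ` induce the same scalar product on `D`. -/
theorem isGraph_image (hD' : IsDirac H (image ρ θ))
    (hP : ∀ x e, P x e = sharp g x (θ x e) + ρ x e)
    (hN : ∀ x e, N x e = sharp g x (θ x e) - ρ x e)
    (hN' : ∀ (x : M) (σ : ∀ x, D x), SmoothSec σ x → SmoothVec (fun y ↦ N y (σ y)) x)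
    (hP' : ∀ (x : M) (X : ∀ x : M, TM E x), SmoothVec X x →
      SmoothSec (fun y ↦ (P y).symm (X y)) x) :
    IsGraph g (fun x ↦ (P x).symm.trans (N x)) (image ρ θ) := by
  have key : ∀ (x : M) (e : D x),
      param g (fun x ↦ (P x).symm.trans (N x)) x ((1 / 2 : ℝ) • P x e) = (ρ x e, θ x e) := by
    intro x e
    have h1 : (1 / 2 : ℝ) • P x e - (1 / 2 : ℝ) • N x e = ρ x e := by
      rw [hP, hN]
      module
    have h2 : (1 / 2 : ℝ) • P x e + (1 / 2 : ℝ) • N x e = sharp g x (θ x e) := by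
      rw [hP, hN]
      module
    simp only [param, LinearEquiv.trans_apply, map_smul, LinearEquiv.symm_apply_apply, h1, h2]
    rw [sharp, LinearEquiv.apply_symm_apply]
  refine ⟨fun x v w ↦ ?_, fun x X hX ↦ hN' x _ (hP' x X hX), fun x ξ ↦ ⟨?_, ?_⟩⟩
  · obtain ⟨e, rfl⟩ := (P x).surjective v
    obtain ⟨f, rfl⟩ := (P x).surjective w
    simp only [LinearEquiv.trans_apply, LinearEquiv.symm_apply_apply]
    rw [hN, hN, hP, hP, inner_sharp_add hD', inner_sharp_sub hD']
  · rintro ⟨e, rfl⟩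
    exact ⟨_, (key x e).symm⟩
  · rintro ⟨a, rfl⟩
    refine ⟨(P x).symm ((2 : ℝ) • a), ?_⟩
    have h := key x ((P x).symm ((2 : ℝ) • a))
    have h2 : (1 / 2 : ℝ) • (2 : ℝ) • a = a := by module
    rw [LinearEquiv.apply_symm_apply, h2] at h
    exact h.symm

theorem param_apply (hP : ∀ x e, P x e = sharp g x (θ x e) + ρ x e)
    (hA : ∀ x e, A x e = (1 / 2 : ℝ) • P x e) (hO : IsGraph g O (image ρ θ)) (x : M) (e : D x) :
    param g O x (A x e) = (ρ x e, θ x e) := by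
  obtain ⟨a, ha⟩ := (hO.graph x (ρ x e, θ x e)).1 ⟨e, rfl⟩
  rw [hA, hP, ← eq_half_of_param ha, ha]

end Orthogonal

/-! ### The Levi-Civita connection carried to `D` -/

section LeviCivita

variable {E : Type*} [NormedAddCommGroup E] [NormedSpace ℝ E]
  {M : Type*} [TopologicalSpace M] [ChartedSpace E M] [IsManifold 𝓘(ℝ, E) ∞ M]
  {g : Metric E M} {H : ThreeForm E M} {D : ∀ x : M, Submodule ℝ (GenTM E x)}
  {nab : CovariantDerivative 𝓘(ℝ, E) E (fun x : M ↦ TangentSpace 𝓘(ℝ, E) x)}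
  {ρ : ∀ x, D x →ₗ[ℝ] TM E x} {θ : ∀ x, D x →ₗ[ℝ] TsM E x} {P N A : ∀ x, D x ≃ₗ[ℝ] TM E x}
  {T φ : ∀ x : M, D x →ₗ[ℝ] TM E x →ₗ[ℝ] D x} {O : ∀ x : M, TM E x ≃ₗ[ℝ] TM E x}
  {x : M} {a : ∀ x : M, TM E x}

/-- For the Levi-Civita connection carried to `D` by `A = ½ (θ* + ρ)`, the map `θ* + ρ` is
parallel, so that only the `H`-term of `T` remains. -/
theorem torsionCoeff_transport [FiniteDimensional ℝ E] (hA : ∀ x e, A x e = (1 / 2 : ℝ) • P x e)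
    (hρA : ∀ x b, ρ x ((A x).symm b) = b - O x b)
    (hT : IsTorsionCoeff g nab (transport nab A) H ρ P T) (ha : SmoothVec a x)
    (hσ : SmoothSec (fun y ↦ (A y).symm (a y)) x) (w : TM E x) :
    A x (T x ((A x).symm (a x)) w) =
      (1 / 4 : ℝ) • sharp g x (H.val x w (a x - O x (a x))) := by
  have hP : ∀ x e, P x e = (2 : ℝ) • A x e := fun x e ↦ by
    rw [hA]
    module
  have hcov : covHom nab (transport nab A) (fun y ↦ (P y).toLinearMap)
      (fun y ↦ (A y).symm (a y)) x w = 0 := by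
    simp only [covHom, transport, LinearEquiv.coe_coe, hP, LinearMap.comp_apply,
      LinearEquiv.apply_symm_apply]
    rw [nab_const_smul ha]
    exact sub_self _
  have h := hT x _ hσ w
  rw [hcov, hρA, zero_sub, H.swap_left x _ w, map_neg (sharp g x), smul_neg, neg_neg] at h
  rw [h, hA, LinearEquiv.apply_symm_apply]
  module

/-- Here `ρ = (id - O) A`, hence `∇ρ = -(∇O) A`, and `N = 2 O A` is inverted by `O⁻¹`. -/
theorem phiCoeff_transport (hNA : ∀ x e, N x e = (2 : ℝ) • O x (A x e))
    (hρA : ∀ x b, ρ x ((A x).symm b) = b - O x b)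
    (hφ : IsPhiCoeff nab (transport nab A) ρ N T φ) (ha : SmoothVec a x)
    (hOa : SmoothVec (fun y ↦ O y (a y)) x)
    (hσ : SmoothSec (fun y ↦ (A y).symm (a y)) x) {w K : TM E x}
    (hK : A x (T x ((A x).symm (a x)) w) = (1 / 4 : ℝ) • K) :
    A x (φ x ((A x).symm (a x)) w) =
      -((1 / 2 : ℝ) • (O x).symm (covEnd nab (fun y ↦ (O y).toLinearMap) a x w))
        + (1 / 8 : ℝ) • (K - (O x).symm K) := by
  have hcov : covHom nab (transport nab A) ρ (fun y ↦ (A y).symm (a y)) x w =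
      -covEnd nab (fun y ↦ (O y).toLinearMap) a x w := by
    simp only [covHom, covEnd, transport, LinearEquiv.coe_coe, LinearMap.comp_apply,
      LinearEquiv.apply_symm_apply, hρA]
    rw [nab_sub ha hOa]
    change _ - _ - (nab a x w - O x (nab a x w)) = _
    abel
  have hρT : ρ x (T x ((A x).symm (a x)) w) = (1 / 4 : ℝ) • K - (1 / 4 : ℝ) • O x K := by
    rw [← map_smul (O x), ← hK, ← hρA, LinearEquiv.symm_apply_apply]
  have h := congr_arg (N x) (hφ x _ hσ w)
  rw [LinearEquiv.apply_symm_apply, hcov, hρT, hNA] at h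
  apply (O x).injective
  simp only [map_add, map_neg, map_sub, map_smul, LinearEquiv.apply_symm_apply]
  rw [← one_smul ℝ (O x _), show (1 : ℝ) = (1 / 2) * 2 by norm_num, mul_smul, h]
  module

theorem covEnd_id_sub (ha : SmoothVec a x) (hOa : SmoothVec (fun y ↦ O y (a y)) x)
    (w : TM E x) :
    covEnd nab (fun y ↦ LinearMap.id - (O y).toLinearMap) a x w =
      -covEnd nab (fun y ↦ (O y).toLinearMap) a x w := by
  simp only [covEnd, LinearMap.sub_apply, LinearMap.id_apply, LinearEquiv.coe_coe]
  rw [nab_sub ha hOa]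
  abel

/-- The connections in terms of the orthogonal operator `O` of the image, for the Levi-Civita
connection carried to `D`. -/
theorem omegaConn_transport_formulas [FiniteDimensional ℝ E]
    (hP : ∀ x e, P x e = sharp g x (θ x e) + ρ x e)
    (hN : ∀ x e, N x e = sharp g x (θ x e) - ρ x e)
    (hA : ∀ x e, A x e = (1 / 2 : ℝ) • P x e)
    (hA' : ∀ (x : M) (X : ∀ x : M, TM E x), SmoothVec X x →
      SmoothSec (fun y ↦ (A y).symm (X y)) x)
    (hO : IsGraph g O (image ρ θ)) (hT : IsTorsionCoeff g nab (transport nab A) H ρ P T)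
    (hφ : IsPhiCoeff nab (transport nab A) ρ N T φ) (ha : SmoothVec a x) (w : TM E x) :
    let σ : ∀ y, D y := fun y ↦ (A y).symm (a y)
    let nablaO := omegaConn (transport nab A) T φ
    let dO := covEnd nab (fun y ↦ (O y).toLinearMap) a x w
    let K := sharp g x (H.val x w (a x - O x (a x)))
    A x (nablaO σ x w) =
      nab a x w + (1 / 2 : ℝ) • (O x).symm dO + (1 / 8 : ℝ) • (K + (O x).symm K) ∧
    A x (φ x (σ x) w) =
      -((1 / 2 : ℝ) • (O x).symm dO) + (1 / 8 : ℝ) • (K - (O x).symm K) ∧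
    A x (plusConn nablaO φ σ x w) = nab a x w + (1 / 4 : ℝ) • K ∧
    A x (minusConn nablaO φ σ x w) =
      nab a x w - (O x).symm
        (covEnd nab (fun y ↦ LinearMap.id - (O y).toLinearMap) a x w - (1 / 4 : ℝ) • K) := by
  have hpar := param_apply hP hA hO
  have hρA : ∀ x b, ρ x ((A x).symm b) = b - O x b := fun x b ↦ by
    have h := congr_arg Prod.fst (hpar x ((A x).symm b))
    rw [LinearEquiv.apply_symm_apply] at h
    exact h.symm
  have hNA : ∀ x e, N x e = (2 : ℝ) • O x (A x e) := fun x e ↦ by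
    have h : A x e - O x (A x e) = ρ x e := congr_arg Prod.fst (hpar x e)
    have h' : O x (A x e) = A x e - ρ x e := by rw [← h, sub_sub_cancel]
    rw [h', hA, hN, hP]
    module
  have hOa := hO.smooth x a ha
  have hσ := hA' x a ha
  have hTa := torsionCoeff_transport hA hρA hT ha hσ w
  have hφa := phiCoeff_transport hNA hρA hφ ha hOa hσ hTa
  intro σ nablaO dO K
  have hsum : A x (nablaO σ x w) + A x (φ x (σ x) w) = nab a x w + (1 / 4 : ℝ) • K := by
    rw [← map_add, omegaConn_add, map_add, hTa]
    congr 1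
    simp only [transport, LinearMap.comp_apply, LinearEquiv.coe_coe,
      LinearEquiv.apply_symm_apply, σ]
    rfl
  have homega : A x (nablaO σ x w) = nab a x w + (1 / 2 : ℝ) • (O x).symm dO
      + (1 / 8 : ℝ) • (K + (O x).symm K) := by
    rw [eq_sub_of_add_eq hsum, hφa]
    module
  refine ⟨homega, hφa, ?_, ?_⟩
  · rw [← hsum]
    exact map_add (A x) _ _
  · have hminus : minusConn nablaO φ σ x w + φ x (σ x) w = nablaO σ x w := by
      change nablaO σ x w - φ x (σ x) w + φ x (σ x) w = _
      abel
    have h := congr_arg (A x) hminus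
    rw [map_add, homega, hφa] at h
    have hsymm : ∀ u v : TM E x, (O x).symm (-u - (1 / 4 : ℝ) • v) =
        -(O x).symm u - (1 / 4 : ℝ) • (O x).symm v := fun u v ↦ by
      rw [map_sub, map_neg, map_smul]
    rw [eq_sub_of_add_eq h, covEnd_id_sub ha hOa, hsymm]
    module

end LeviCivita

end DiracSigma

theorem mainTheorem3 {E : Type*} [NormedAddCommGroup E] [NormedSpace ℝ E] [FiniteDimensional ℝ E]
    {M : Type*} [TopologicalSpace M] [ChartedSpace E M] [IsManifold 𝓘(ℝ, E) ∞ M]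
    (g : DiracSigma.Metric E M)
    (H : DiracSigma.ThreeForm E M) (hH : H.IsClosedForm)
    (nab : CovariantDerivative 𝓘(ℝ, E) E (fun x : M ↦ TangentSpace 𝓘(ℝ, E) x))
    (hnab : DiracSigma.IsLeviCivita g nab)
    (D : ∀ x : M, Submodule ℝ (DiracSigma.GenTM E x)) (hD : DiracSigma.IsDirac H D)
    (ρ : ∀ x, D x →ₗ[ℝ] DiracSigma.TM E x) (θ : ∀ x, D x →ₗ[ℝ] DiracSigma.TsM E x)
    (hρ : ∀ (x : M) (σ : ∀ x, D x), DiracSigma.SmoothSec σ x →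
      DiracSigma.SmoothVec (fun y ↦ ρ y (σ y)) x)
    (hθ : ∀ (x : M) (σ : ∀ x, D x), DiracSigma.SmoothSec σ x →
      DiracSigma.SmoothForm (fun y ↦ θ y (σ y)) x)
    (hD' : DiracSigma.IsDirac H (DiracSigma.image ρ θ)) :
    -- the operators `θ* + ρ` and `θ* - ρ` are invertible; `A = (θ* + ρ) / 2`
    ∃ P N A : ∀ x, D x ≃ₗ[ℝ] DiracSigma.TM E x,
      (∀ x e, P x e = DiracSigma.sharp g x (θ x e) + ρ x e) ∧
      (∀ x e, N x e = DiracSigma.sharp g x (θ x e) - ρ x e) ∧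
      (∀ x e, A x e = (1 / 2 : ℝ) • P x e) ∧
      (∀ (x : M) (X : ∀ x : M, DiracSigma.TM E x), DiracSigma.SmoothVec X x →
        DiracSigma.SmoothSec (fun y ↦ (P y).symm (X y)) x ∧
        DiracSigma.SmoothSec (fun y ↦ (N y).symm (X y)) x) ∧
      -- the explicit solution of the invariance conditions, for any reference connection on `D`
      (∀ nablaD : (∀ x, D x) → ∀ x : M, DiracSigma.TM E x →ₗ[ℝ] D x,
        DiracSigma.IsConnection nablaD →
        ∃ T φ : ∀ x : M, D x →ₗ[ℝ] DiracSigma.TM E x →ₗ[ℝ] D x,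
          DiracSigma.SmoothEndForm T ∧ DiracSigma.SmoothEndForm φ ∧
          DiracSigma.IsTorsionCoeff g nab nablaD H ρ P T ∧
          DiracSigma.IsPhiCoeff nab nablaD ρ N T φ ∧
          DiracSigma.IsConnection (DiracSigma.omegaConn nablaD T φ) ∧
          DiracSigma.InvarianceMetric g ρ θ (DiracSigma.omegaConn nablaD T φ) φ ∧
          DiracSigma.InvarianceForm g H ρ θ (DiracSigma.omegaConn nablaD T φ) φ ∧
          DiracSigma.IsConnection (DiracSigma.plusConn (DiracSigma.omegaConn nablaD T φ) φ) ∧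
          DiracSigma.IsConnection (DiracSigma.minusConn (DiracSigma.omegaConn nablaD T φ) φ) ∧
          (∀ (x : M) (σ : ∀ x, D x), DiracSigma.SmoothSec σ x → ∀ w : DiracSigma.TM E x,
            DiracSigma.plusConn (DiracSigma.omegaConn nablaD T φ) φ σ x w =
              nablaD σ x w + T x (σ x) w ∧
            DiracSigma.minusConn (DiracSigma.omegaConn nablaD T φ) φ σ x w =
              nablaD σ x w + T x (σ x) w - (2 : ℝ) • (N x).symm
                (DiracSigma.covHom nab nablaD ρ σ x w - ρ x (T x (σ x) w)))) ∧
      -- the same in terms of the orthogonal operator, for the Levi-Civita connection on `D`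
      DiracSigma.IsConnection (DiracSigma.transport nab A) ∧
      (∃ O : ∀ x : M, DiracSigma.TM E x ≃ₗ[ℝ] DiracSigma.TM E x,
        DiracSigma.IsGraph g O (DiracSigma.image ρ θ)) ∧
      (∀ O : ∀ x : M, DiracSigma.TM E x ≃ₗ[ℝ] DiracSigma.TM E x,
        DiracSigma.IsGraph g O (DiracSigma.image ρ θ) →
        (∀ x e, DiracSigma.param g O x (A x e) = (ρ x e, θ x e)) ∧
        ∀ T φ : ∀ x : M, D x →ₗ[ℝ] DiracSigma.TM E x →ₗ[ℝ] D x,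
          DiracSigma.IsTorsionCoeff g nab (DiracSigma.transport nab A) H ρ P T →
          DiracSigma.IsPhiCoeff nab (DiracSigma.transport nab A) ρ N T φ →
          ∀ (x : M) (a : ∀ x : M, DiracSigma.TM E x), DiracSigma.SmoothVec a x →
          ∀ w : DiracSigma.TM E x,
            let σ : ∀ y, D y := fun y ↦ (A y).symm (a y)
            let nablaO := DiracSigma.omegaConn (DiracSigma.transport nab A) T φ
            let dO := DiracSigma.covEnd nab (fun y ↦ (O y).toLinearMap) a x w
            let K := DiracSigma.sharp g x (H.val x w (a x - O x (a x)))
            A x (nablaO σ x w) =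
              nab a x w + (1 / 2 : ℝ) • (O x).symm dO + (1 / 8 : ℝ) • (K + (O x).symm K) ∧
            A x (φ x (σ x) w) =
              -((1 / 2 : ℝ) • (O x).symm dO) + (1 / 8 : ℝ) • (K - (O x).symm K) ∧
            A x (DiracSigma.plusConn nablaO φ σ x w) = nab a x w + (1 / 4 : ℝ) • K ∧
            A x (DiracSigma.minusConn nablaO φ σ x w) =
              nab a x w - (O x).symm
                (DiracSigma.covEnd nab
                  (fun y ↦ LinearMap.id - (O y).toLinearMap) a x w
                  - (1 / 4 : ℝ) • K)) ∧
      -- if `ρ ⊕ θ` matches the parametrizations of `D` and of its image by orthogonal operators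
      -- (e.g. if it is the inclusion), `A` is the inverse of the parametrization of `D`
      (∀ O O' : ∀ x : M, DiracSigma.TM E x ≃ₗ[ℝ] DiracSigma.TM E x,
        DiracSigma.IsGraph g O D → DiracSigma.IsGraph g O' (DiracSigma.image ρ θ) →
        (∀ (x : M) (e : D x) (a : DiracSigma.TM E x), e.1 = DiracSigma.param g O x a →
          (ρ x e, θ x e) = DiracSigma.param g O' x a) →
        ∀ (x : M) (e : D x), DiracSigma.param g O x (A x e) = e.1) := by
  obtain ⟨P, hP⟩ := DiracSigma.exists_sharp_add_equiv g hD hD'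
  obtain ⟨N, hN⟩ := DiracSigma.exists_sharp_sub_equiv g hD hD'
  let A : ∀ x, D x ≃ₗ[ℝ] DiracSigma.TM E x := fun x ↦
    (P x).trans (LinearEquiv.smulOfNeZero ℝ _ (1 / 2 : ℝ) (by norm_num))
  have hA : ∀ x e, A x e = (1 / 2 : ℝ) • P x e := fun x e ↦ rfl
  have hθ' : ∀ (x : M) (σ : ∀ x, D x), DiracSigma.SmoothSec σ x →
      DiracSigma.SmoothVec (fun y ↦ DiracSigma.sharp g y (θ y (σ y))) x := fun x σ hσ ↦
    DiracSigma.smoothVec_sharp g fun Y hY ↦ (hθ x σ hσ).apply hY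
  have hPs : ∀ (x : M) (σ : ∀ x, D x), DiracSigma.SmoothSec σ x →
      DiracSigma.SmoothVec (fun y ↦ P y (σ y)) x := fun x σ hσ ↦ by
    simpa only [hP] using (hθ' x σ hσ).add (hρ x σ hσ)
  have hNs : ∀ (x : M) (σ : ∀ x, D x), DiracSigma.SmoothSec σ x →
      DiracSigma.SmoothVec (fun y ↦ N y (σ y)) x := fun x σ hσ ↦ by
    simpa only [hN] using (hθ' x σ hσ).sub (hρ x σ hσ)
  have hAs : ∀ (x : M) (σ : ∀ x, D x), DiracSigma.SmoothSec σ x →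
      DiracSigma.SmoothVec (fun y ↦ A y (σ y)) x := fun x σ hσ ↦
    .smul (DiracSigma.smoothFun_const _ x) (hPs x σ hσ)
  have hP' : ∀ (x : M) (X : ∀ x : M, DiracSigma.TM E x), DiracSigma.SmoothVec X x →
      DiracSigma.SmoothSec (fun y ↦ (P y).symm (X y)) x := fun x X hX ↦
    DiracSigma.smoothSec_symm_apply g hD hPs hX
  have hA' : ∀ (x : M) (X : ∀ x : M, DiracSigma.TM E x), DiracSigma.SmoothVec X x →
      DiracSigma.SmoothSec (fun y ↦ (A y).symm (X y)) x := fun x X hX ↦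
    DiracSigma.smoothSec_symm_apply g hD hAs hX
  refine ⟨P, N, A, hP, hN, hA,
    fun x X hX ↦ ⟨hP' x X hX, DiracSigma.smoothSec_symm_apply g hD hNs hX⟩, ?_,
    DiracSigma.isConnection_transport hnab hAs hA',
    ⟨_, DiracSigma.isGraph_image hD' hP hN hNs hP'⟩, ?_, ?_⟩
  · intro nablaD hnablaD
    obtain ⟨T, hTs, hT⟩ := DiracSigma.exists_torsionCoeff hnab hD hnablaD hρ hPs
    obtain ⟨φ, hφs, hφ⟩ := DiracSigma.exists_phiCoeff hnab hD hnablaD hρ hNs hTs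
    have homega : DiracSigma.IsConnection (DiracSigma.omegaConn nablaD T φ) := by
      -- `∇^ω` is `∇^D` plus the section `T - φ` of `T*M ⊗ End D`.
      refine hnablaD.add_endForm (hTs.add (hφs.const_smul (-1))) fun σ x w ↦ ?_
      rw [eq_comm, LinearMap.add_apply, LinearMap.add_apply, LinearMap.smul_apply,
        LinearMap.smul_apply, ← add_assoc, ← DiracSigma.omegaConn_add]
      module
    refine ⟨T, φ, hTs, hφs, hT, hφ, homega, DiracSigma.invarianceMetric hnab hN hρ hφ,
      DiracSigma.invarianceForm hnab hP hN hρ hθ' hT hφ,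
      homega.add_endForm hφs fun σ x w ↦ rfl,
      homega.add_endForm (hφs.const_smul (-1)) fun σ x w ↦ ?_, fun x σ hσ w ↦ ⟨?_, ?_⟩⟩
    · change DiracSigma.omegaConn nablaD T φ σ x w - φ x (σ x) w =
        DiracSigma.omegaConn nablaD T φ σ x w + (-1 : ℝ) • φ x (σ x) w
      module
    · exact DiracSigma.omegaConn_add nablaD T φ σ x w
    · rw [← hφ x σ hσ w, ← DiracSigma.omegaConn_add]
      change DiracSigma.omegaConn nablaD T φ σ x w - φ x (σ x) w = _
      module
  · intro O hO
    exact ⟨DiracSigma.param_apply hP hA hO, fun T φ hT hφ x a ha w ↦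
      DiracSigma.omegaConn_transport_formulas hP hN hA hA' hO hT hφ ha w⟩
  · intro O O' hO hO' h x e
    obtain ⟨a, ha⟩ := (hO.graph x e.1).1 e.2
    have h1 := h x e a ha
    rw [hA, hP, ← DiracSigma.eq_half_of_param h1, ha]
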